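/- Let $E$ be the set of edges of the nearest-neighbour graph on $\mathbb{Z}^2$, and let $|v|$ denote the $\ell^1$-norm of $v\in\mathbb{Z}^2$. For $v\neq 0$, a flow from $0$ to $v$ is an antisymmetric function $\theta$ on the oriented edges such that $\sum_{y\sim x}\theta(\overrightarrow{xy})=0$ for every vertex $x\notin\{0,v\}$ and $\sum_{y\sim 0}\theta(\overrightarrow{0y})=\sum_{y\sim v}\theta(\overrightarrow{yv})$; the common value of these last two sums is its strength $\|\theta\|$. For resistances $r=(r_e)_{e\in E}$ with $r_e>0$, the point-to-point effective resistance is $$\mathcal{R}_r(0\leftrightarrow v)=\inf_{\|\theta\|=1}\ \sum_{e\in E} r_e\,\theta(e)^2 ,$$ the infimum being over all flows $\theta$ from $0$ to $v$ of strength $1$. Let $0<a\le b<+\infty$, let $\nu=\tfrac12\delta_a+\tfrac12\delta_b$, and let $\mu=\nu^{\otimes E}$, so that under $\mu$ the resistances are i.i.d. with law $\nu$. Then for every $v\ne 0$ the random variable $r\mapsto\mathcal{R}_r(0\leftrightarrow v)$ is square integrable under $\mu$, and there are constants $c,C>0$ and $N$, depending only on $a$ and $b$, such that for all $v\in\mathbb{Z}^2$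 with $|v|\ge N$, $$\mathrm{Var}_\mu\big(\mathcal{R}_r(0\leftrightarrow v)\big)\le C\,(\log|v|)^{2/3} \qquad\text{and}\qquad c\log|v|\ \le\ \mathbb{E}_\mu\big(\mathcal{R}_r(0\leftrightarrow v)\big)\ \le\ C\log|v| .$$ -/

import Mathlib

open MeasureTheory ProbabilityTheory

/-- A flow from the vertex `s` to the vertex `t` on a locally finite graph `G`: an antisymmetric
function on the oriented edges (extended by `0` to all ordered pairs of vertices) which satisfies
the node law away from `s` and `t`, and whose flow out of `s` equals its flow into `t`. -/
structure SimpleGraph.ElectricFlow {V : Type*} (G : SimpleGraph V) [G.LocallyFinite]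
    (s t : V) where
  val : V → V → ℝ
  antisymm : ∀ x y, val x y = -val y x
  eq_zero_of_not_adj : ∀ x y, ¬ G.Adj x y → val x y = 0
  node_law : ∀ x, x ≠ s → x ≠ t → ∑ y ∈ G.neighborFinset x, val x y = 0
  balance : ∑ y ∈ G.neighborFinset s, val s y = ∑ y ∈ G.neighborFinset t, val y t

namespace SimpleGraph

variable {V : Type*} {G : SimpleGraph V} [G.LocallyFinite] {s t : V}

/-- The strength of a flow. -/
def ElectricFlow.strength (θ : G.ElectricFlow s t) : ℝ :=
  ∑ y ∈ G.neighborFinset s, θ.val s y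

/-- The square `θ(e)²`, which does not depend on the orientation of the edge `e`. -/
def ElectricFlow.sq (θ : G.ElectricFlow s t) : Sym2 V → ℝ :=
  Sym2.lift ⟨fun x y => θ.val x y ^ 2, fun x y => by
    show θ.val x y ^ 2 = θ.val y x ^ 2
    rw [θ.antisymm x y, neg_sq]⟩

end SimpleGraph

/-- The point-to-point effective resistance: the infimum of the energies `∑ₑ rₑ θ(e)²` of the flows
`θ` from `s` to `t` of strength `1`. Flows of infinite energy do not contribute to the infimum. -/
noncomputable def SimpleGraph.effectiveResistance {V : Type*} (G : SimpleGraph V)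
    [G.LocallyFinite] (r : G.edgeSet → ℝ) (s t : V) : ℝ :=
  sInf {x : ℝ | ∃ θ : G.ElectricFlow s t, θ.strength = 1 ∧
    HasSum (fun e : G.edgeSet => r e * θ.sq e) x}

/-- The `ℓ¹` norm on `ℤ²`. -/
def l1Norm (v : ℤ × ℤ) : ℕ := v.1.natAbs + v.2.natAbs

/-- The nearest-neighbour graph on `ℤ²`. -/
def squareLattice : SimpleGraph (ℤ × ℤ) where
  Adj x y := l1Norm (x - y) = 1
  symm := ⟨fun x y h => by simp only [l1Norm, Prod.fst_sub, Prod.snd_sub] at *; omega⟩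
  loopless := ⟨fun x h => by simp [l1Norm] at h⟩

instance squareLattice.locallyFinite : squareLattice.LocallyFinite := fun x =>
  Fintype.ofFinset {(x.1 + 1, x.2), (x.1 - 1, x.2), (x.1, x.2 + 1), (x.1, x.2 - 1)} (by
    rintro ⟨y₁, y₂⟩
    obtain ⟨x₁, x₂⟩ := x
    simp only [Finset.mem_insert, Finset.mem_singleton, Prod.mk.injEq,
      SimpleGraph.mem_neighborSet, squareLattice, l1Norm, Prod.fst_sub, Prod.snd_sub]
    omega)

/-- The law `½ δ_a + ½ δ_b` on `ℝ`. -/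
noncomputable def bernoulliLaw (a b : ℝ) : Measure ℝ :=
  (2⁻¹ : ENNReal) • Measure.dirac a + (2⁻¹ : ENNReal) • Measure.dirac b

instance bernoulliLaw.isProbabilityMeasure (a b : ℝ) :
    IsProbabilityMeasure (bernoulliLaw a b) :=
  ⟨by simp [bernoulliLaw, ENNReal.inv_two_add_inv_two]⟩

/-- The law of i.i.d. resistances on the edges of `ℤ²` with marginal `½ δ_a + ½ δ_b`. -/
noncomputable def resistanceLaw (a b : ℝ) : Measure (squareLattice.edgeSet → ℝ) :=
  Measure.infinitePi fun _ => bernoulliLaw a b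

/-!
Let `u` be the potential of the unit current from `x` to `y` in the network with conductances
`c = 1 / r`, obtained as a Riesz representative in the Hilbert space of functions of finite energy.
Because `ℤ²` is recurrent, every flow of finite energy pairs with `u` like the unit current does,
so that the effective resistance is `u x - u y`.

Its expectation: testing `u` against a logarithmic cutoff bounds the resistance from below by a
multiple of `log |x - y|`; for the upper bound, Cauchy–Schwarz along expanding antidiagonals shows
that a function of finite energy oscillates by at most a multiple of `√(log |x - y|)`.

Its variance: resampling the resistance of `e` changes the effective resistance by at most
`(b - a) θ(e)²`, where `θ` is the current, so the Efron–Stein inequality bounds the variance by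
`(b - a)² 𝔼 ∑ θ(e)⁴`. By reciprocity the gradient of `u` along an edge is the difference between `x`
and `y` of a potential with poles at the ends of the edge. The maximum principle on concentric boxes
makes its square at most of order `1 / log n` when `x` and `y` are at distance more than `n` from
the edge, while the edges within distance `n` of `x` or `y` carry energy of order `log n`.
Hence `∑ θ(e)⁴` is of order `log n + log |x - y| / log n`, and `log n = √(log |x - y|)` gives a
variance of order `√(log |x - y|)`, below the required power `2 / 3`.
-/

open Filter Topology

namespace ElectricNetwork

section SquareSummable

variable {ι : Type*} {f g : ι → ℝ}

lemma summable_mul_of_summable_sq (hf : Summable fun i => f i ^ 2)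
    (hg : Summable fun i => g i ^ 2) : Summable fun i => f i * g i :=
  Summable.of_norm_bounded (hf.add hg) fun i => by
    rw [Real.norm_eq_abs, abs_le]
    constructor <;> nlinarith [sq_nonneg (f i + g i), sq_nonneg (f i - g i)]

lemma tsum_mul_sq_le_tsum_sq_mul_tsum_sq (hf : Summable fun i => f i ^ 2)
    (hg : Summable fun i => g i ^ 2) :
    (∑' i, f i * g i) ^ 2 ≤ (∑' i, f i ^ 2) * ∑' i, g i ^ 2 :=
  le_of_tendsto_of_tendsto ((summable_mul_of_summable_sq hf hg).hasSum.pow 2)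
    (Tendsto.mul hf.hasSum hg.hasSum)
    (Eventually.of_forall fun s => s.sum_mul_sq_le_sq_mul_sq f g)

/-- Uniform ellipticity of a family of conductances or resistances: all of them lie in `[m, M]`,
where `0 < m ≤ M`. -/
structure Elliptic (m M : ℝ) (c : ι → ℝ) : Prop where
  pos : 0 < m
  le : m ≤ M
  lower : ∀ i, m ≤ c i
  upper : ∀ i, c i ≤ M

variable {m M : ℝ} {c : ι → ℝ}

lemma Elliptic.pos_apply (hc : Elliptic m M c) (i : ι) : 0 < c i :=
  hc.pos.trans_le (hc.lower i)

lemma Elliptic.inv (hc : Elliptic m M c) : Elliptic M⁻¹ m⁻¹ fun i => (c i)⁻¹ where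
  pos := inv_pos.2 (hc.pos.trans_le hc.le)
  le := inv_anti₀ hc.pos hc.le
  lower i := inv_anti₀ (hc.pos_apply i) (hc.upper i)
  upper i := inv_anti₀ hc.pos (hc.lower i)

lemma Elliptic.summable_mul_mul (hc : Elliptic m M c) (hf : Summable fun i => f i ^ 2)
    (hg : Summable fun i => g i ^ 2) : Summable fun i => c i * f i * g i :=
  Summable.of_norm_bounded ((summable_mul_of_summable_sq hf hg).abs.mul_left M) fun i => by
    rw [Real.norm_eq_abs, mul_assoc, abs_mul, abs_of_pos (hc.pos_apply i)]
    exact mul_le_mul_of_nonneg_right (hc.upper i) (abs_nonneg _)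

end SquareSummable

section Gradient

variable {V : Type*}

/-- The restriction of a function on ordered pairs to the edges, each of which is given an arbitrary
orientation. For antisymmetric functions a product of two restrictions does not depend on it. -/
noncomputable def orient (α : V → V → ℝ) (e : Sym2 V) : ℝ :=
  α (Quot.out e).1 (Quot.out e).2

lemma orient_mul_orient {α β : V → V → ℝ} (hα : ∀ x y, α x y = -α y x)
    (hβ : ∀ x y, β x y = -β y x) (x y : V) :
    orient α s(x, y) * orient β s(x, y) = α x y * β x y := by
  have h : s((Quot.out s(x, y)).1, (Quot.out s(x, y)).2) = s(x, y) := Quot.out_eq _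
  rcases Sym2.eq_iff.1 h with ⟨h₁, h₂⟩ | ⟨h₁, h₂⟩
  · rw [orient, orient, h₁, h₂]
  · rw [orient, orient, h₁, h₂, hα y x, hβ y x, neg_mul_neg]

variable (G : SimpleGraph V)

/-- The discrete gradient, along the orientation of the edges chosen in `orient`. -/
noncomputable def grad : (V → ℝ) →ₗ[ℝ] G.edgeSet → ℝ where
  toFun f e := orient (fun x y => f y - f x) e
  map_add' f g := by ext e; simp only [orient, Pi.add_apply]; ring
  map_smul' a f := by ext e; simp only [orient, Pi.smul_apply, smul_eq_mul, RingHom.id_apply]; ring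

lemma grad_apply (f : V → ℝ) (e : G.edgeSet) :
    grad G f e = f (Quot.out e.1).2 - f (Quot.out e.1).1 := rfl

lemma grad_mul (f g : V → ℝ) (e : G.edgeSet) :
    grad G (f * g) e = f (Quot.out e.1).1 * grad G g e + g (Quot.out e.1).2 * grad G f e := by
  simp only [grad_apply, Pi.mul_apply]
  ring

variable {G} {f g : V → ℝ} {x y : V}

lemma orient_mul_grad {α : V → V → ℝ} (hα : ∀ x y, α x y = -α y x) (f : V → ℝ) (h : G.Adj x y) :
    orient α s(x, y) * grad G f ⟨s(x, y), h⟩ = α x y * (f y - f x) :=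
  orient_mul_orient (β := fun x y => f y - f x) hα (fun _ _ => (neg_sub _ _).symm) x y

lemma grad_sq_mk (f : V → ℝ) (h : G.Adj x y) : grad G f ⟨s(x, y), h⟩ ^ 2 = (f y - f x) ^ 2 := by
  rw [sq, sq]
  exact orient_mul_grad (α := fun x y => f y - f x) (fun _ _ => (neg_sub _ _).symm) f h

lemma eq_of_grad_eq_zero (hG : G.Connected) (hf : grad G f = 0) (x y : V) : f x = f y := by
  obtain ⟨w⟩ := hG.preconnected x y
  induction w with
  | nil => rfl
  | cons h _ ih =>
    have h' := grad_sq_mk f h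
    rw [hf, Pi.zero_apply, zero_pow two_ne_zero, eq_comm, sq_eq_zero_iff, sub_eq_zero] at h'
    exact h'.symm.trans ih

variable (G) in
/-- The Dirichlet energy of a function with unit conductances (`0` if the sum diverges). -/
noncomputable def energy (f : V → ℝ) : ℝ := ∑' e, grad G f e ^ 2

variable (G) in
/-- Functions whose gradient is square summable. -/
def FiniteEnergy (f : V → ℝ) : Prop := Summable fun e => grad G f e ^ 2

/-- The Dirichlet form with conductances `c`. -/
noncomputable def dirichletForm (c : G.edgeSet → ℝ) (f g : V → ℝ) : ℝ :=
  ∑' e, c e * grad G f e * grad G g e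

lemma energy_nonneg (f : V → ℝ) : 0 ≤ energy G f := tsum_nonneg fun _ => sq_nonneg _

lemma FiniteEnergy.neg (hf : FiniteEnergy G f) : FiniteEnergy G (-f) := by
  simpa only [FiniteEnergy, map_neg, Pi.neg_apply, neg_sq] using hf

lemma FiniteEnergy.sum_grad_sq_le (hf : FiniteEnergy G f) (s : Finset G.edgeSet) :
    ∑ e ∈ s, grad G f e ^ 2 ≤ energy G f :=
  hf.sum_le_tsum s fun _ _ => sq_nonneg _

lemma FiniteEnergy.sum_sub_sq_le (hf : FiniteEnergy G f) {ι : Type*} {s : Finset ι}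
    {p q : ι → V} (hpq : ∀ i, G.Adj (p i) (q i)) (hinj : Set.InjOn (fun i => s(p i, q i)) s) :
    ∑ i ∈ s, (f (q i) - f (p i)) ^ 2 ≤ energy G f := by
  classical
  have hinj' : Set.InjOn (fun i => (⟨s(p i, q i), hpq i⟩ : G.edgeSet)) s :=
    fun i hi j hj h => hinj hi hj (congrArg Subtype.val h)
  simp only [← grad_sq_mk f (hpq _)]
  rw [← Finset.sum_image (f := fun e => grad G f e ^ 2) hinj']
  exact hf.sum_grad_sq_le _

lemma dirichletForm_comm (c : G.edgeSet → ℝ) (f g : V → ℝ) :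
    dirichletForm c f g = dirichletForm c g f :=
  tsum_congr fun _ => mul_right_comm _ _ _

variable {m M : ℝ} {c : G.edgeSet → ℝ}

lemma Elliptic.mul_energy_le (hc : Elliptic m M c) (hf : FiniteEnergy G f) :
    m * energy G f ≤ dirichletForm c f f := by
  rw [energy, ← tsum_mul_left]
  refine Summable.tsum_le_tsum (fun e => ?_) (hf.mul_left m) (hc.summable_mul_mul hf hf)
  rw [mul_assoc, ← sq]
  exact mul_le_mul_of_nonneg_right (hc.lower e) (sq_nonneg _)

lemma Elliptic.le_mul_energy (hc : Elliptic m M c) (hf : FiniteEnergy G f) :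
    dirichletForm c f f ≤ M * energy G f := by
  rw [energy, ← tsum_mul_left]
  refine Summable.tsum_le_tsum (fun e => ?_) (hc.summable_mul_mul hf hf) (hf.mul_left M)
  rw [mul_assoc, ← sq]
  exact mul_le_mul_of_nonneg_right (hc.upper e) (sq_nonneg _)

lemma Elliptic.dirichletForm_self_nonneg (hc : Elliptic m M c) (f : V → ℝ) :
    0 ≤ dirichletForm c f f :=
  tsum_nonneg fun e => by
    rw [mul_assoc]
    exact mul_nonneg (hc.pos_apply e).le (mul_self_nonneg _)

lemma Elliptic.dirichletForm_sq_le (hc : Elliptic m M c) (hf : FiniteEnergy G f)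
    (hg : FiniteEnergy G g) :
    dirichletForm c f g ^ 2 ≤ dirichletForm c f f * dirichletForm c g g := by
  have weight : ∀ h k : V → ℝ, ∀ e, (√(c e) * grad G h e) * (√(c e) * grad G k e) =
      c e * grad G h e * grad G k e := fun h k e => by
    rw [mul_mul_mul_comm, Real.mul_self_sqrt (hc.pos_apply e).le, mul_assoc]
  have hs : ∀ h, FiniteEnergy G h → Summable fun e => (√(c e) * grad G h e) ^ 2 := fun h hh => by
    simpa only [sq, weight] using hc.summable_mul_mul hh hh
  simpa only [sq (√ _ * _), weight, dirichletForm] using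
    tsum_mul_sq_le_tsum_sq_mul_tsum_sq (hs f hf) (hs g hg)

end Gradient

section Potential

variable {V : Type*} {G : SimpleGraph V} {m M : ℝ} {c : G.edgeSet → ℝ}

lemma Elliptic.memℓp_sqrt_mul_grad (hc : Elliptic m M c) {f : V → ℝ} (hf : FiniteEnergy G f) :
    Memℓp (fun e => √(c e) * grad G f e) 2 := by
  refine memℓp_gen ((hc.summable_mul_mul hf hf).congr fun e => ?_)
  simp only [ENNReal.toReal_ofNat, Real.rpow_two, Real.norm_eq_abs, sq_abs, mul_pow,
    Real.sq_sqrt (hc.pos_apply e).le, sq (grad G f e), mul_assoc]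

/-- The weighted gradients `√c ∇f` in `ℓ²`; their inner product is the Dirichlet form. -/
noncomputable def gradientSpace (c : G.edgeSet → ℝ) :
    Submodule ℝ (lp (fun _ : G.edgeSet => ℝ) 2) where
  carrier := {g | ∃ f : V → ℝ, ∀ e, g e = √(c e) * grad G f e}
  zero_mem' := ⟨0, by simp⟩
  add_mem' := by
    rintro _ _ ⟨f, hf⟩ ⟨g, hg⟩
    exact ⟨f + g, fun e => by simp [hf, hg, mul_add]⟩
  smul_mem' := by
    rintro a _ ⟨f, hf⟩
    exact ⟨a • f, fun e => by simp [hf, mul_left_comm]⟩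

lemma Elliptic.finiteEnergy_of_eq (hc : Elliptic m M c) {g : lp (fun _ : G.edgeSet => ℝ) 2}
    {f : V → ℝ} (h : ∀ e, g e = √(c e) * grad G f e) : FiniteEnergy G f := by
  have hg : Summable fun e => g e ^ 2 := by
    simpa only [real_inner_self_eq_norm_sq, Real.norm_eq_abs, sq_abs] using
      lp.summable_inner (𝕜 := ℝ) g g
  refine Summable.of_nonneg_of_le (fun _ => sq_nonneg _) (fun e => ?_) (hg.mul_left m⁻¹)
  rw [h, mul_pow, Real.sq_sqrt (hc.pos_apply e).le, ← mul_assoc]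
  refine le_mul_of_one_le_left (sq_nonneg _) ?_
  rw [inv_mul_eq_div, one_le_div hc.pos]
  exact hc.lower e

lemma Elliptic.exists_evaluation_adj (hc : Elliptic m M c) {x y : V} (h : G.Adj x y) :
    ∃ p : lp (fun _ : G.edgeSet => ℝ) 2, ∀ (g : lp (fun _ : G.edgeSet => ℝ) 2) (f : V → ℝ),
      (∀ e, g e = √(c e) * grad G f e) → inner ℝ p g = f y - f x := by
  classical
  have hs := (Real.sqrt_pos.2 (hc.pos_apply ⟨s(x, y), h⟩)).ne'
  refine ⟨lp.single 2 ⟨s(x, y), h⟩ ((√(c ⟨s(x, y), h⟩))⁻¹ *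
    orient (fun z w => (Pi.single y 1 : V → ℝ) w - (Pi.single y 1 : V → ℝ) z) s(x, y)),
    fun g f hg => ?_⟩
  rw [lp.inner_single_left, hg, RCLike.inner_apply, conj_trivial, mul_comm, mul_mul_mul_comm,
    inv_mul_cancel₀ hs, one_mul, orient_mul_grad (fun _ _ => (neg_sub _ _).symm),
    Pi.single_eq_same, Pi.single_eq_of_ne h.ne, sub_zero, one_mul]

lemma Elliptic.exists_evaluation (hc : Elliptic m M c) {x y : V} (h : G.Reachable x y) :
    ∃ p : lp (fun _ : G.edgeSet => ℝ) 2, ∀ (g : lp (fun _ : G.edgeSet => ℝ) 2) (f : V → ℝ),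
      (∀ e, g e = √(c e) * grad G f e) → inner ℝ p g = f y - f x := by
  obtain ⟨w⟩ := h
  induction w with
  | nil => exact ⟨0, fun g f _ => by simp⟩
  | cons hadj _ ih =>
    obtain ⟨p, hp⟩ := ih
    obtain ⟨q, hq⟩ := hc.exists_evaluation_adj hadj
    exact ⟨p + q, fun g f hg => by rw [inner_add_left, hp g f hg, hq g f hg, sub_add_sub_cancel]⟩

lemma Elliptic.isClosed_gradientSpace (hc : Elliptic m M c) (hG : G.Connected) :
    IsClosed (gradientSpace c : Set (lp (fun _ : G.edgeSet => ℝ) 2)) := by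
  refine IsSeqClosed.isClosed fun g l hg hl => ?_
  choose f hf using hg
  obtain ⟨o⟩ := hG.nonempty
  choose p hp using fun x => hc.exists_evaluation (hG.preconnected o x)
  have tendsto_f : ∀ x, Tendsto (fun n => f n x - f n o) atTop (𝓝 (inner ℝ (p x) l)) := fun x =>
    (tendsto_const_nhds.inner hl).congr fun n => hp x (g n) (f n) (hf n)
  refine ⟨fun x => inner ℝ (p x) l, fun e => tendsto_nhds_unique
    (((lp.uniformContinuous_coe.continuous.tendsto l).comp hl).apply_nhds e) ?_⟩
  refine (((tendsto_f _).sub (tendsto_f _)).const_mul √(c e)).congr fun n => ?_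
  rw [sub_sub_sub_cancel_right]
  exact (hf n e).symm

/-- `u` is a potential of the unit current flow from `x` to `y` in the network with conductances
`c`. Testing against all functions of finite energy encodes `div (c ∇u) = δ_y - δ_x`. -/
structure IsPotential (c : G.edgeSet → ℝ) (x y : V) (u : V → ℝ) : Prop where
  finiteEnergy : FiniteEnergy G u
  form_eq : ∀ f, FiniteEnergy G f → dirichletForm c u f = f x - f y

theorem Elliptic.exists_isPotential (hc : Elliptic m M c) (hG : G.Connected) (x y : V) :
    ∃ u, IsPotential c x y u := by
  obtain ⟨p, hp⟩ := hc.exists_evaluation (hG.preconnected y x)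
  have := (hc.isClosed_gradientSpace hG).completeSpace_coe
  obtain ⟨u, hu⟩ := ((gradientSpace c).orthogonalProjectionOnto p).2
  refine ⟨u, hc.finiteEnergy_of_eq hu, fun f hf => ?_⟩
  let g : lp (fun _ : G.edgeSet => ℝ) 2 := ⟨_, hc.memℓp_sqrt_mul_grad hf⟩
  have hg : g ∈ gradientSpace c := ⟨f, fun _ => rfl⟩
  have inner_eq : inner ℝ g ((gradientSpace c).orthogonalProjectionOnto p : lp _ 2) =
      inner ℝ g p := Submodule.inner_orthogonalProjectionOnto_eq_of_mem_left ⟨g, hg⟩ p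
  rw [← hp g f fun _ => rfl, real_inner_comm, ← inner_eq, lp.inner_eq_tsum]
  refine tsum_congr fun e => ?_
  rw [hu, RCLike.inner_apply, conj_trivial, mul_mul_mul_comm,
    Real.mul_self_sqrt (hc.pos_apply e).le, mul_assoc]

end Potential

section MaximumPrinciple

variable {V : Type*} {G : SimpleGraph V} {m M : ℝ} {c : G.edgeSet → ℝ} {x y z t : V}
  {u w f : V → ℝ}

lemma IsPotential.neg (hu : IsPotential c x y u) : IsPotential c y x (-u) where
  finiteEnergy := hu.finiteEnergy.neg
  form_eq f hf := by
    rw [← neg_sub, ← hu.form_eq f hf, dirichletForm, dirichletForm, ← tsum_neg]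
    refine tsum_congr fun e => ?_
    rw [map_neg, Pi.neg_apply, mul_neg, neg_mul]

lemma IsPotential.form_self (hu : IsPotential c x y u) : dirichletForm c u u = u x - u y :=
  hu.form_eq u hu.finiteEnergy

lemma IsPotential.reciprocity (hu : IsPotential c x y u) (hw : IsPotential c z t w) :
    u z - u t = w x - w y := by
  rw [← hu.form_eq w hw.finiteEnergy, dirichletForm_comm, hw.form_eq u hu.finiteEnergy]

lemma IsPotential.mul_energy_le (hc : Elliptic m M c) (hu : IsPotential c x y u) :
    m * energy G u ≤ u x - u y :=
  hu.form_self ▸ hc.mul_energy_le hu.finiteEnergy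

lemma IsPotential.energy_le (hc : Elliptic m M c) (hu : IsPotential c x y u) :
    energy G u ≤ (u x - u y) / m := by
  rw [le_div_iff₀' hc.pos]
  exact hu.mul_energy_le hc

lemma IsPotential.sink_le_source (hc : Elliptic m M c) (hu : IsPotential c x y u) : u y ≤ u x :=
  sub_nonneg.1 (hu.form_self ▸ hc.dirichletForm_self_nonneg u)

lemma IsPotential.sub_sq_le (hc : Elliptic m M c) (hu : IsPotential c x y u)
    (hf : FiniteEnergy G f) : (f x - f y) ^ 2 ≤ (u x - u y) * (M * energy G f) := by
  rw [← hu.form_eq f hf]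
  refine (hc.dirichletForm_sq_le hu.finiteEnergy hf).trans ?_
  rw [hu.form_self]
  exact mul_le_mul_of_nonneg_left (hc.le_mul_energy hf) (sub_nonneg.2 (hu.sink_le_source hc))

/-- `f` is obtained from `u` by a contraction of the range of `u`, as for `f = max (u - B) 0`. This
is the property of truncations behind the maximum principle. -/
def IsTruncation (G : SimpleGraph V) (u f : V → ℝ) : Prop :=
  ∀ z w, G.Adj z w → (f w - f z) ^ 2 ≤ (u w - u z) * (f w - f z)

lemma max_zero_sub_sq_le (p q : ℝ) :
    (max p 0 - max q 0) ^ 2 ≤ (p - q) * (max p 0 - max q 0) := by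
  rcases max_cases p 0 with ⟨h₁, _⟩ | ⟨h₁, _⟩ <;> rcases max_cases q 0 with ⟨h₂, _⟩ | ⟨h₂, _⟩ <;>
    rw [h₁, h₂] <;> nlinarith

lemma isTruncation_max (u : V → ℝ) (B : ℝ) : IsTruncation G u fun z => max (u z - B) 0 :=
  fun z w _ => by simpa only [sub_sub_sub_cancel_right] using
    max_zero_sub_sq_le (u w - B) (u z - B)

lemma isTruncation_indicator_max (W : Set V) {B : ℝ}
    (hB : ∀ z ∉ W, ∀ w ∈ W, G.Adj z w → u z ≤ B) :
    IsTruncation G u (W.indicator fun z => max (u z - B) 0) := by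
  intro z w h
  have htr := isTruncation_max u B z w h
  by_cases hz : z ∈ W <;> by_cases hw : w ∈ W
  · simpa only [Set.indicator_of_mem hz, Set.indicator_of_mem hw] using htr
  · have := hB w hw z hz h.symm
    simpa only [Set.indicator_of_mem hz, Set.indicator_of_notMem hw,
      max_eq_right (sub_nonpos.2 this)] using htr
  · have := hB z hz w hw h
    simpa only [Set.indicator_of_notMem hz, Set.indicator_of_mem hw,
      max_eq_right (sub_nonpos.2 this)] using htr
  · simp only [Set.indicator_of_notMem hz, Set.indicator_of_notMem hw, sub_self, mul_zero,
      zero_pow two_ne_zero, le_refl]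

lemma IsTruncation.grad_sq_le (h : IsTruncation G u f) (e : G.edgeSet) :
    grad G f e ^ 2 ≤ grad G u e * grad G f e := by
  refine h _ _ ?_
  have he : s((Quot.out e.1).1, (Quot.out e.1).2) = e.1 := Quot.out_eq _
  rw [← SimpleGraph.mem_edgeSet, he]
  exact e.2

lemma IsTruncation.finiteEnergy (h : IsTruncation G u f) (hu : FiniteEnergy G u) :
    FiniteEnergy G f :=
  Summable.of_nonneg_of_le (fun _ => sq_nonneg _)
    (fun e => by nlinarith [h.grad_sq_le e, sq_nonneg (grad G u e - grad G f e)]) hu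

lemma IsPotential.eq_of_isTruncation (hc : Elliptic m M c) (hG : G.Connected)
    (hu : IsPotential c x y u) (h : IsTruncation G u f) (hxy : f x ≤ f y) (z w : V) :
    f z = f w := by
  have hf := h.finiteEnergy hu.finiteEnergy
  have form_le : dirichletForm c f f ≤ dirichletForm c u f := by
    refine Summable.tsum_le_tsum (fun e => ?_) (hc.summable_mul_mul hf hf)
      (hc.summable_mul_mul hu.finiteEnergy hf)
    rw [mul_assoc, mul_assoc, ← sq]
    exact mul_le_mul_of_nonneg_left (h.grad_sq_le e) (hc.pos_apply e).le
  have energy_nonpos : energy G f ≤ 0 := by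
    rw [hu.form_eq f hf] at form_le
    refine nonpos_of_mul_nonpos_right ?_ hc.pos
    linarith [hc.mul_energy_le hf]
  have hsum : HasSum (fun e => grad G f e ^ 2) (energy G f) := hf.hasSum
  rw [energy_nonpos.antisymm (energy_nonneg f),
    hasSum_zero_iff_of_nonneg fun e => sq_nonneg _] at hsum
  exact eq_of_grad_eq_zero hG (funext fun e => sq_eq_zero_iff.1 (congrFun hsum e)) z w

lemma IsPotential.le_source (hc : Elliptic m M c) (hG : G.Connected) (hu : IsPotential c x y u)
    (z : V) : u z ≤ u x := by
  have h := hu.eq_of_isTruncation hc hG (isTruncation_max u (u x))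
    (by simp [hu.sink_le_source hc]) z x
  simpa using h

lemma IsPotential.sink_le (hc : Elliptic m M c) (hG : G.Connected) (hu : IsPotential c x y u)
    (z : V) : u y ≤ u z :=
  neg_le_neg_iff.1 (hu.neg.le_source hc hG z)

lemma IsPotential.source_sub_le (hc : Elliptic m M c) (hG : G.Connected)
    (hu : IsPotential c x y u) (hw : IsPotential c x z w) : u x - u z ≤ w x - w z := by
  rw [hu.reciprocity hw]
  exact sub_le_sub_left (hw.sink_le hc hG y) _

theorem IsPotential.le_of_boundary_le (hc : Elliptic m M c) (hG : G.Connected)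
    (hu : IsPotential c x y u) {W : Set V} (hx : x ∉ W) (hy : y ∉ W) {B : ℝ}
    (hB : ∀ z ∉ W, ∀ w ∈ W, G.Adj z w → u z ≤ B) (hz : z ∈ W) : u z ≤ B := by
  have h := hu.eq_of_isTruncation hc hG (isTruncation_indicator_max W hB)
    (by simp only [Set.indicator_of_notMem hx, Set.indicator_of_notMem hy, le_refl]) z x
  rwa [Set.indicator_of_mem hz, Set.indicator_of_notMem hx, max_eq_right_iff, sub_nonpos] at h

lemma IsPotential.sub_le_of_adj (hc : Elliptic m M c) (hu : IsPotential c x y u)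
    (h : G.Adj x y) : u x - u y ≤ 1 / m := by
  have hsq : (u x - u y) ^ 2 ≤ (u x - u y) / m := by
    rw [← neg_sub, neg_sq, ← grad_sq_mk u h]
    simpa using (hu.finiteEnergy.sum_grad_sq_le {⟨s(x, y), h⟩}).trans (hu.energy_le hc)
  rcases (sub_nonneg.2 (hu.sink_le_source hc)).eq_or_lt with h₀ | h₀
  · rw [← h₀]
    exact (one_div_pos.2 hc.pos).le
  · refine le_of_mul_le_mul_left ?_ h₀
    rwa [mul_one_div, ← sq]

lemma IsPotential.energy_le_of_adj (hc : Elliptic m M c) (hu : IsPotential c x y u)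
    (h : G.Adj x y) : energy G u ≤ 1 / m ^ 2 := by
  rw [sq, ← div_div]
  exact (hu.energy_le hc).trans (div_le_div_of_nonneg_right (hu.sub_le_of_adj hc h) hc.pos.le)

lemma IsPotential.sub_sq_le_of_adj (hc : Elliptic m M c) (hG : G.Connected)
    (hu : IsPotential c x y u) (h : G.Adj z t) : (u z - u t) ^ 2 ≤ 1 / m ^ 2 := by
  obtain ⟨w, hw⟩ := hc.exists_isPotential hG z t
  rw [hu.reciprocity hw, ← one_div_pow]
  refine sq_le_sq' ?_ ?_ <;>
    linarith [hw.sub_le_of_adj hc h, hw.le_source hc hG x, hw.le_source hc hG y,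
      hw.sink_le hc hG x, hw.sink_le hc hG y]

lemma IsPotential.grad_sq_le (hc : Elliptic m M c) (hG : G.Connected)
    (hu : IsPotential c x y u) (e : G.edgeSet) : grad G u e ^ 2 ≤ 1 / m ^ 2 := by
  obtain ⟨e, he⟩ := e
  induction e with
  | h z t =>
    rw [grad_sq_mk u he]
    exact hu.sub_sq_le_of_adj hc hG he.symm

theorem IsPotential.sum_grad_sq_le_of_superlevel (hc : Elliptic m M c)
    (hu : IsPotential c x y u) {B : ℝ} (hB : 0 ≤ B) {s : Finset G.edgeSet}
    (hs : ∀ e ∈ s, ∀ z ∈ e.1, u x - B ≤ u z) : ∑ e ∈ s, grad G u e ^ 2 ≤ B / m := by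
  set f : V → ℝ := fun z => max (u z - (u x - B)) 0 with hf_def
  have htr : IsTruncation G u f := isTruncation_max u _
  have hf := htr.finiteEnergy hu.finiteEnergy
  have form_le : dirichletForm c u f ≤ B := by
    have hfx : f x = B := by simp only [hf_def, sub_sub_cancel, max_eq_left hB]
    rw [hu.form_eq f hf, hfx]
    exact sub_le_self B (le_max_right _ _)
  have grad_eq : ∀ e ∈ s, grad G f e = grad G u e := fun e he => by
    simp only [grad_apply, hf_def, max_eq_left (sub_nonneg.2 (hs e he _ (Sym2.out_fst_mem _))),
      max_eq_left (sub_nonneg.2 (hs e he _ (Sym2.out_snd_mem _))), sub_sub_sub_cancel_right]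
  rw [le_div_iff₀' hc.pos, Finset.mul_sum]
  calc ∑ e ∈ s, m * grad G u e ^ 2
      ≤ ∑ e ∈ s, c e * grad G u e * grad G f e := Finset.sum_le_sum fun e he => by
        rw [grad_eq e he, mul_assoc, ← sq]
        exact mul_le_mul_of_nonneg_right (hc.lower e) (sq_nonneg _)
    _ ≤ dirichletForm c u f := (hc.summable_mul_mul hu.finiteEnergy hf).sum_le_tsum _
        fun e _ => by
          rw [mul_assoc]
          exact mul_nonneg (hc.pos_apply e).le ((sq_nonneg _).trans (htr.grad_sq_le e))
    _ ≤ B := form_le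

end MaximumPrinciple

section SummationByParts

variable {V : Type*} {G : SimpleGraph V} [G.LocallyFinite] {α : V → V → ℝ}

variable (G) in
/-- The divergence of a function on ordered pairs, which plays the role of an edge flow. -/
def divergence (α : V → V → ℝ) (z : V) : ℝ := ∑ w ∈ G.neighborFinset z, α z w

lemma hasSum_orient_mul_grad_single [DecidableEq V] (hα : ∀ x y, α x y = -α y x) (z : V) :
    HasSum (fun e : G.edgeSet => orient α e * grad G (Pi.single z 1) e) (-divergence G α z) := by
  let star : G.neighborFinset z → G.edgeSet :=
    fun w => ⟨s(z, w), (G.mem_neighborFinset z w).1 w.2⟩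
  have star_injective : Function.Injective star := fun w w' h =>
    Subtype.ext (Sym2.congr_right.1 (congrArg Subtype.val h))
  have vanish : ∀ e ∉ Set.range star, orient α e * grad G (Pi.single z 1) e = 0 := by
    intro e he
    have hmem : ∀ w, s(z, w) ≠ e.1 := fun w hw =>
      he ⟨⟨w, (G.mem_neighborFinset z w).2 (G.mem_edgeSet.1 (hw ▸ e.2))⟩, Subtype.ext hw⟩
    have hout : s((Quot.out e.1).1, (Quot.out e.1).2) = e.1 := Quot.out_eq _
    rw [grad_apply, Pi.single_eq_of_ne, Pi.single_eq_of_ne, sub_self, mul_zero]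
    · exact fun h => hmem (Quot.out e.1).2 (h ▸ hout)
    · exact fun h => hmem (Quot.out e.1).1 (h ▸ Sym2.eq_swap.trans hout)
  rw [← star_injective.hasSum_iff vanish, divergence, ← Finset.sum_coe_sort,
    ← Finset.sum_neg_distrib]
  convert hasSum_fintype _ using 2 with w
  have hw := (G.mem_neighborFinset z w).1 w.2
  simp only [star, Function.comp_apply]
  rw [orient_mul_grad hα _ hw, Pi.single_eq_same, Pi.single_eq_of_ne hw.ne', zero_sub, mul_neg_one]

lemma hasSum_orient_mul_grad (hα : ∀ x y, α x y = -α y x) (φ : V →₀ ℝ) :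
    HasSum (fun e : G.edgeSet => orient α e * grad G φ e)
      (-φ.sum fun z a => a * divergence G α z) := by
  classical
  induction φ using Finsupp.induction_linear with
  | zero => simp
  | add φ ψ hφ hψ =>
    rw [Finsupp.sum_add_index' (by simp) (by simp [add_mul]), neg_add]
    simpa only [Finsupp.coe_add, map_add, Pi.add_apply, mul_add] using hφ.add hψ
  | single z a =>
    rw [Finsupp.sum_single_index (zero_mul _), ← mul_neg]
    refine ((hasSum_orient_mul_grad_single hα z).mul_left a).congr_fun fun e => ?_
    rw [mul_left_comm, ← smul_eq_mul a (grad G _ e), ← Pi.smul_apply, ← map_smul, ← Pi.single_smul,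
      smul_eq_mul, mul_one, Finsupp.single_eq_pi_single]

lemma finiteEnergy_finsupp (φ : V →₀ ℝ) : FiniteEnergy G φ := by
  have h := (hasSum_orient_mul_grad (G := G) (α := fun x y => φ y - φ x)
    (fun _ _ => (neg_sub _ _).symm) φ).summable
  exact h.congr fun e => (sq _).symm

variable {x y : V}

lemma divergence_flow [DecidableEq V] (θ : G.ElectricFlow x y) (z : V) :
    divergence G θ.val z =
      θ.strength * ((Pi.single z 1 : V → ℝ) x - (Pi.single z 1 : V → ℝ) y) := by
  have sink : divergence G θ.val y = -θ.strength := by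
    rw [SimpleGraph.ElectricFlow.strength, θ.balance, ← Finset.sum_neg_distrib]
    exact Finset.sum_congr rfl fun w _ => θ.antisymm y w
  have source : divergence G θ.val x = θ.strength := rfl
  rcases eq_or_ne z x with rfl | hx <;> rcases eq_or_ne z y with rfl | hy
  · rw [sub_self, mul_zero]
    linarith
  · rw [source, Pi.single_eq_same, Pi.single_eq_of_ne hy.symm, sub_zero, mul_one]
  · rw [sink, Pi.single_eq_same, Pi.single_eq_of_ne hx.symm, zero_sub, mul_neg_one]
  · rw [divergence, θ.node_law z hx hy, Pi.single_eq_of_ne hx.symm, Pi.single_eq_of_ne hy.symm,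
      sub_self, mul_zero]

lemma tsum_flow_mul_grad (θ : G.ElectricFlow x y) (φ : V →₀ ℝ) :
    ∑' e : G.edgeSet, orient θ.val e * grad G φ e = -(θ.strength * (φ x - φ y)) := by
  classical
  rw [(hasSum_orient_mul_grad θ.antisymm φ).tsum_eq, neg_inj]
  have eval : ∀ t, φ.sum (fun z a => a * (Pi.single z 1 : V → ℝ) t) = φ t := fun t => by
    simp only [Pi.single_apply, mul_ite, mul_one, mul_zero, Finsupp.sum_ite_self_eq]
  simp only [divergence_flow, mul_left_comm _ θ.strength, mul_sub, Finsupp.sum_sub]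
  rw [← Finsupp.mul_sum, ← Finsupp.mul_sum, eval, eval]

end SummationByParts

section Recurrence

variable {V : Type*} {G : SimpleGraph V}

/-- Recurrence of a network with bounded conductances, in the form of finitely supported cutoff
functions which tend to `1` while their energies tend to `0`. -/
def IsRecurrent (G : SimpleGraph V) : Prop :=
  ∃ η : ℕ → V →₀ ℝ, (∀ n z, |η n z| ≤ 1) ∧ (∀ z, Tendsto (fun n => η n z) atTop (𝓝 1)) ∧
    Tendsto (fun n => energy G (η n)) atTop (𝓝 0)

lemma tendsto_tsum_mul_of_bounded {ι : Type*} {k : ι → ℝ} (hk : Summable k) {a : ℕ → ι → ℝ}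
    (ha : ∀ n i, |a n i| ≤ 1) (hlim : ∀ i, Tendsto (fun n => a n i) atTop (𝓝 1)) :
    Tendsto (fun n => ∑' i, a n i * k i) atTop (𝓝 (∑' i, k i)) := by
  refine tendsto_tsum_of_dominated_convergence hk.abs (fun i => ?_)
    (Eventually.of_forall fun n i => ?_)
  · simpa only [one_mul] using (hlim i).mul_const (k i)
  · rw [Real.norm_eq_abs, abs_mul]
    exact mul_le_of_le_one_left (abs_nonneg _) (ha n i)

lemma tendsto_tsum_mul_grad_zero {k : G.edgeSet → ℝ} (hk : Summable fun e => k e ^ 2)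
    {η : ℕ → V → ℝ} (hη : ∀ n, FiniteEnergy G (η n))
    (hlim : Tendsto (fun n => energy G (η n)) atTop (𝓝 0)) :
    Tendsto (fun n => ∑' e, k e * grad G (η n) e) atTop (𝓝 0) := by
  have hsqrt : Tendsto (fun n => √((∑' e, k e ^ 2) * energy G (η n))) atTop (𝓝 0) := by
    simpa using (hlim.const_mul (∑' e, k e ^ 2)).sqrt
  exact squeeze_zero_norm
    (fun n => Real.abs_le_sqrt (tsum_mul_sq_le_tsum_sq_mul_tsum_sq hk (hη n))) hsqrt

variable [G.LocallyFinite] {x y : V} {u : V → ℝ}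

/- The summation by parts formula holds for `η u` with `η` finitely supported. In the limit `η → 1`
the term with the gradient of `η` disappears because `G` is recurrent. -/
lemma tsum_flow_mul_grad_of_bounded (hG : IsRecurrent G) (θ : G.ElectricFlow x y)
    (hθ : Summable fun e : G.edgeSet => orient θ.val e ^ 2) (hu : FiniteEnergy G u) {B : ℝ}
    (hB : ∀ z, |u z| ≤ B) :
    ∑' e : G.edgeSet, orient θ.val e * grad G u e = -(θ.strength * (u x - u y)) := by
  obtain ⟨η, η_le, η_lim, energy_lim⟩ := hG
  have hθg := summable_mul_of_summable_sq hθ hu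
  let k : G.edgeSet → ℝ := fun e => orient θ.val e * u (Quot.out e.1).2
  have hk : Summable fun e => k e ^ 2 := by
    refine Summable.of_nonneg_of_le (fun _ => sq_nonneg _) (fun e => ?_) (hθ.mul_right (B ^ 2))
    rw [mul_pow]
    exact mul_le_mul_of_nonneg_left (sq_le_sq.2 ((hB _).trans (le_abs_self B))) (sq_nonneg _)
  have leibniz : ∀ n, -(θ.strength * (η n x * u x - η n y * u y)) =
      ∑' e : G.edgeSet, η n (Quot.out e.1).1 * (orient θ.val e * grad G u e) +
        ∑' e, k e * grad G (η n) e := fun n => by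
    have hη := finiteEnergy_finsupp (G := G) (η n)
    let φ : V →₀ ℝ := Finsupp.onFinset (η n).support (fun z => η n z * u z)
      fun z hz => Finsupp.mem_support_iff.2 (left_ne_zero_of_mul hz)
    have hφ : (φ : V → ℝ) = η n * u := rfl
    have hs : Summable fun e : G.edgeSet =>
        η n (Quot.out e.1).1 * (orient θ.val e * grad G u e) :=
      Summable.of_norm_bounded hθg.abs fun e => by
        rw [Real.norm_eq_abs, abs_mul]
        exact mul_le_of_le_one_left (abs_nonneg _) (η_le n _)
    rw [← hs.tsum_add (summable_mul_of_summable_sq hk hη)]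
    refine (tsum_flow_mul_grad θ φ).symm.trans (tsum_congr fun e => ?_)
    rw [hφ, grad_mul]
    ring
  have rhs_lim := (tendsto_tsum_mul_of_bounded hθg (fun n e => η_le n (Quot.out e.1).1)
    fun e => η_lim _).add
      (tendsto_tsum_mul_grad_zero hk (fun n => finiteEnergy_finsupp (η n)) energy_lim)
  have lhs_lim := ((((η_lim x).mul_const (u x)).sub ((η_lim y).mul_const (u y))).const_mul
    θ.strength).neg
  rw [add_zero] at rhs_lim
  rw [one_mul, one_mul] at lhs_lim
  exact tendsto_nhds_unique (rhs_lim.congr fun n => (leibniz n).symm) lhs_lim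

end Recurrence

section EffectiveResistance

variable {V : Type*} {G : SimpleGraph V} {x y : V} {u : V → ℝ} {a b : ℝ}

open Classical in
/-- The current driven by the potential `u`. -/
noncomputable def current (c : G.edgeSet → ℝ) (u : V → ℝ) (z w : V) : ℝ :=
  if h : G.Adj z w then c ⟨s(z, w), h⟩ * (u z - u w) else 0

lemma current_antisymm (c : G.edgeSet → ℝ) (u : V → ℝ) (z w : V) :
    current c u z w = -current c u w z := by
  by_cases h : G.Adj z w
  · have he : (⟨s(z, w), h⟩ : G.edgeSet) = ⟨s(w, z), h.symm⟩ := Subtype.ext Sym2.eq_swap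
    rw [current, current, dif_pos h, dif_pos h.symm, he, ← mul_neg, neg_sub]
  · rw [current, current, dif_neg h, dif_neg fun h' => h h'.symm, neg_zero]

lemma orient_current (c : G.edgeSet → ℝ) (u : V → ℝ) (e : G.edgeSet) :
    orient (current c u) e = -(c e * grad G u e) := by
  have he : s((Quot.out e.1).1, (Quot.out e.1).2) = e.1 := Quot.out_eq _
  have h : G.Adj (Quot.out e.1).1 (Quot.out e.1).2 := by
    rw [← SimpleGraph.mem_edgeSet, he]
    exact e.2
  rw [orient, current, dif_pos h, grad_apply, ← mul_neg, neg_sub]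
  exact congrArg (c · * _) (Subtype.ext he)

variable [G.LocallyFinite]

lemma IsPotential.divergence_current [DecidableEq V] {c : G.edgeSet → ℝ}
    (hu : IsPotential c x y u) (z : V) :
    divergence G (current c u) z = (Pi.single z 1 : V → ℝ) x - (Pi.single z 1 : V → ℝ) y := by
  have hz : FiniteEnergy G (Pi.single z 1) := by
    rw [← Finsupp.single_eq_pi_single]
    exact finiteEnergy_finsupp _
  rw [← hu.form_eq _ hz, ← neg_inj,
    ← (hasSum_orient_mul_grad_single (current_antisymm c u) z).tsum_eq, dirichletForm, ← tsum_neg]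
  exact tsum_congr fun e => by rw [orient_current, neg_mul]

/-- The unit current flow from `x` to `y`. -/
noncomputable def IsPotential.currentFlow {c : G.edgeSet → ℝ} (hu : IsPotential c x y u)
    (hxy : x ≠ y) : G.ElectricFlow x y where
  val := current c u
  antisymm := current_antisymm c u
  eq_zero_of_not_adj _ _ h := dif_neg h
  node_law z hx hy := by
    classical
    refine (hu.divergence_current z).trans ?_
    rw [Pi.single_eq_of_ne hx.symm, Pi.single_eq_of_ne hy.symm, sub_zero]
  balance := by
    classical
    have hx := hu.divergence_current x
    have hy := hu.divergence_current y
    rw [divergence, Pi.single_eq_same, Pi.single_eq_of_ne hxy.symm, sub_zero] at hx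
    rw [divergence, Pi.single_eq_same, Pi.single_eq_of_ne hxy, zero_sub, ← neg_inj, neg_neg,
      ← Finset.sum_neg_distrib] at hy
    rw [hx, ← hy]
    exact Finset.sum_congr rfl fun w _ => (current_antisymm c u w y).symm

lemma IsPotential.strength_currentFlow {c : G.edgeSet → ℝ} (hu : IsPotential c x y u)
    (hxy : x ≠ y) : (hu.currentFlow hxy).strength = 1 := by
  classical
  refine (hu.divergence_current x).trans ?_
  rw [Pi.single_eq_same, Pi.single_eq_of_ne hxy.symm, sub_zero]

lemma flow_sq_eq (θ : G.ElectricFlow x y) (e : Sym2 V) : θ.sq e = orient θ.val e ^ 2 := by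
  conv_lhs => rw [← Quot.out_eq e]
  rfl

variable {r : G.edgeSet → ℝ}

lemma IsPotential.hasSum_currentFlow {c : G.edgeSet → ℝ} (hu : IsPotential c x y u) (hxy : x ≠ y)
    {E : ℝ} (hE : HasSum (fun e => r e * (c e * grad G u e) ^ 2) E) :
    HasSum (fun e : G.edgeSet => r e * (hu.currentFlow hxy).sq e) E :=
  hE.congr_fun fun e => by rw [flow_sq_eq, IsPotential.currentFlow, orient_current, neg_sq]

lemma IsPotential.effectiveResistance_le {c : G.edgeSet → ℝ}
    (hu : IsPotential c x y u) (hxy : x ≠ y) (hr : ∀ e, 0 ≤ r e) {E : ℝ}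
    (hE : HasSum (fun e => r e * (c e * grad G u e) ^ 2) E) :
    G.effectiveResistance r x y ≤ E := by
  refine csInf_le ⟨0, ?_⟩ ⟨hu.currentFlow hxy, hu.strength_currentFlow hxy,
    hu.hasSum_currentFlow hxy hE⟩
  rintro E ⟨θ, -, hE⟩
  exact hE.nonneg fun e => by
    rw [flow_sq_eq]
    exact mul_nonneg (hr e) (sq_nonneg _)

omit [G.LocallyFinite] in
lemma IsPotential.hasSum_mul_sq (hr : Elliptic a b r)
    (hu : IsPotential (fun e => (r e)⁻¹) x y u) :
    HasSum (fun e => r e * ((r e)⁻¹ * grad G u e) ^ 2) (u x - u y) := by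
  rw [← hu.form_self]
  refine (hr.inv.summable_mul_mul hu.finiteEnergy hu.finiteEnergy).hasSum.congr_fun fun e => ?_
  have := (hr.pos_apply e).ne'
  field_simp

/-- Thomson's principle. -/
lemma IsPotential.sub_le_of_hasSum (hr : Elliptic a b r) (hG : G.Connected)
    (hrec : IsRecurrent G) (hu : IsPotential (fun e => (r e)⁻¹) x y u) (θ : G.ElectricFlow x y)
    (hθ : θ.strength = 1) {E : ℝ} (hE : HasSum (fun e : G.edgeSet => r e * θ.sq e) E) :
    u x - u y ≤ E := by
  simp only [flow_sq_eq] at hE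
  have hθsq : Summable fun e : G.edgeSet => orient θ.val e ^ 2 := by
    refine Summable.of_nonneg_of_le (fun _ => sq_nonneg _) (fun e => ?_) (hE.summable.mul_left a⁻¹)
    rw [← mul_assoc]
    refine le_mul_of_one_le_left (sq_nonneg _) ?_
    rw [inv_mul_eq_div, one_le_div hr.pos]
    exact hr.lower e
  have cross := (summable_mul_of_summable_sq hθsq hu.finiteEnergy).hasSum
  rw [tsum_flow_mul_grad_of_bounded hrec θ hθsq hu.finiteEnergy (B := max |u y| |u x|)
    (fun z => abs_le_max_abs_abs (hu.sink_le hr.inv hG z) (hu.le_source hr.inv hG z)),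
    hθ, one_mul] at cross
  have total := (hE.add (cross.mul_left 2)).add (hu.hasSum_mul_sq hr)
  have : 0 ≤ E + 2 * -(u x - u y) + (u x - u y) := total.nonneg fun e => by
    have hre := hr.pos_apply e
    have square : r e * orient θ.val e ^ 2 + 2 * (orient θ.val e * grad G u e) +
        r e * ((r e)⁻¹ * grad G u e) ^ 2 =
        r e * (orient θ.val e + (r e)⁻¹ * grad G u e) ^ 2 := by
      field_simp
      ring
    rw [square]
    exact mul_nonneg hre.le (sq_nonneg _)
  linarith

theorem IsPotential.effectiveResistance_eq (hr : Elliptic a b r) (hG : G.Connected)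
    (hrec : IsRecurrent G) (hxy : x ≠ y) (hu : IsPotential (fun e => (r e)⁻¹) x y u) :
    G.effectiveResistance r x y = u x - u y := by
  have henergy := hu.hasSum_mul_sq hr
  refine le_antisymm (hu.effectiveResistance_le hxy (fun e => (hr.pos_apply e).le) henergy)
    (le_csInf ⟨u x - u y, hu.currentFlow hxy, hu.strength_currentFlow hxy, ?_⟩ ?_)
  · exact hu.hasSum_currentFlow hxy henergy
  · rintro E ⟨θ, hθ, hE⟩
    exact hu.sub_le_of_hasSum hr hG hrec θ hθ hE

end EffectiveResistance

section BoundedMeasurable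

variable {Ω Ω' : Type*} [MeasurableSpace Ω] [MeasurableSpace Ω'] {f g : Ω → ℝ}

/-- A bounded measurable function: the class of random variables to which the averaging argument
for the Efron–Stein inequality is applied. -/
structure BoundedMeasurable (f : Ω → ℝ) : Prop where
  measurable : Measurable f
  bounded : ∃ B, ∀ ω, |f ω| ≤ B

namespace BoundedMeasurable

lemma const (c : ℝ) : BoundedMeasurable fun _ : Ω => c := ⟨measurable_const, |c|, fun _ => le_rfl⟩

lemma sub (hf : BoundedMeasurable f) (hg : BoundedMeasurable g) :
    BoundedMeasurable fun ω => f ω - g ω := by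
  obtain ⟨B, hB⟩ := hf.bounded
  obtain ⟨D, hD⟩ := hg.bounded
  exact ⟨hf.measurable.sub hg.measurable, B + D, fun ω =>
    (abs_sub _ _).trans (add_le_add (hB ω) (hD ω))⟩

lemma mul (hf : BoundedMeasurable f) (hg : BoundedMeasurable g) :
    BoundedMeasurable fun ω => f ω * g ω := by
  obtain ⟨B, hB⟩ := hf.bounded
  obtain ⟨D, hD⟩ := hg.bounded
  refine ⟨hf.measurable.mul hg.measurable, B * D, fun ω => ?_⟩
  rw [abs_mul]
  exact mul_le_mul (hB ω) (hD ω) (abs_nonneg _) ((abs_nonneg _).trans (hB ω))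

lemma sq (hf : BoundedMeasurable f) : BoundedMeasurable fun ω => f ω ^ 2 := by
  simpa only [pow_two] using hf.mul hf

lemma comp (hf : BoundedMeasurable f) {φ : Ω' → Ω} (hφ : Measurable φ) :
    BoundedMeasurable fun ω => f (φ ω) :=
  ⟨hf.measurable.comp hφ, hf.bounded.imp fun _ hB ω => hB (φ ω)⟩

lemma memLp (hf : BoundedMeasurable f) (p : ENNReal) (P : Measure Ω) [IsFiniteMeasure P] :
    MemLp f p P := by
  obtain ⟨B, hB⟩ := hf.bounded
  exact MemLp.of_bound hf.measurable.aestronglyMeasurable B (Eventually.of_forall hB)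

lemma integrable (hf : BoundedMeasurable f) (P : Measure Ω) [IsFiniteMeasure P] : Integrable f P :=
  memLp_one_iff_integrable.1 (hf.memLp 1 P)

end BoundedMeasurable

end BoundedMeasurable

section EfronStein

variable {ι : Type*} [DecidableEq ι] {X : ι → Type*}

lemma preimage_update_pi (e : ι) (s : Finset ι) (t : ∀ i, Set (X i)) :
    (fun z : (∀ i, X i) × X e => Function.update z.1 e z.2) ⁻¹' Set.pi s t =
      Set.pi (s.erase e : Finset ι) t ×ˢ {x | e ∈ s → x ∈ t e} := by
  ext ⟨ω, x⟩
  simp only [Set.mem_preimage, Set.mem_pi, Set.mem_prod, Finset.mem_coe, Finset.mem_erase,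
    Set.mem_ofPred_eq]
  constructor
  · intro h
    exact ⟨fun i hi => by simpa [hi.1] using h i hi.2, fun he => by simpa using h e he⟩
  · rintro ⟨h, he⟩ i hi
    rcases eq_or_ne i e with rfl | hne
    · simpa using he hi
    · simpa [hne] using h i ⟨hne, hi⟩

lemma piecewise_update (F : Finset ι) (ω p : ∀ i, X i) {i : ι} (hi : i ∈ F) (x : X i) :
    F.piecewise (Function.update ω i x) p = Function.update (F.piecewise ω p) i x := by
  ext j
  rcases eq_or_ne j i with rfl | hne
  · simp [hi]
  · by_cases hj : j ∈ F <;> simp [hj, hne]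

variable [∀ i, MeasurableSpace (X i)]

lemma measurable_update_prod (e : ι) :
    Measurable fun z : (∀ i, X i) × X e => Function.update z.1 e z.2 := by
  refine measurable_pi_lambda _ fun i => ?_
  rcases eq_or_ne i e with rfl | hi
  · simpa only [Function.update_self] using measurable_snd
  · simp only [Function.update_of_ne hi]
    exact (measurable_pi_apply i).comp measurable_fst

lemma measurePreserving_update (μ : ∀ i, Measure (X i)) [∀ i, IsProbabilityMeasure (μ i)] (e : ι) :
    MeasurePreserving (fun z : (∀ i, X i) × X e => Function.update z.1 e z.2)
      ((Measure.infinitePi μ).prod (μ e)) (Measure.infinitePi μ) where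
  measurable := measurable_update_prod e
  map_eq := by
    refine Measure.eq_infinitePi μ fun s t ht => ?_
    rw [Measure.map_apply (measurable_update_prod e)
      (MeasurableSet.pi s.countable_toSet fun i _ => ht i), preimage_update_pi, Measure.prod_prod,
      Measure.infinitePi_pi _ fun i _ => ht i]
    by_cases he : e ∈ s
    · simp only [he, forall_const, Set.ofPred_mem_eq]
      exact Finset.prod_erase_mul s _ he
    · simp [he]

variable {μ : ∀ i, Measure (X i)} {f g : (∀ i, X i) → ℝ} {e : ι}

/-- The average of `f` over the coordinate `e`, that is, its conditional expectation given the
other coordinates. -/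
noncomputable def average (μ : ∀ i, Measure (X i)) (e : ι) (f : (∀ i, X i) → ℝ) (ω : ∀ i, X i) :
    ℝ :=
  ∫ x, f (Function.update ω e x) ∂μ e

lemma dependsOn_average {s : Finset ι} (hf : DependsOn f (insert e s : Finset ι)) :
    DependsOn (average μ e f) s := fun ω ω' h => by
  refine integral_congr_ae (Eventually.of_forall fun x => hf fun i hi => ?_)
  rcases eq_or_ne i e with rfl | hne
  · simp
  · simpa [hne] using h i (by simpa [hne] using hi)

variable [∀ i, IsProbabilityMeasure (μ i)]

lemma BoundedMeasurable.average (hf : BoundedMeasurable f) (e : ι) :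
    BoundedMeasurable (average μ e f) := by
  obtain ⟨B, hB⟩ := hf.bounded
  refine ⟨((hf.measurable.comp (measurable_update_prod e)).stronglyMeasurable.integral_prod_right
    (f := fun ω x => f (Function.update ω e x))).measurable, B, fun ω => ?_⟩
  simpa [ElectricNetwork.average, Real.norm_eq_abs] using norm_integral_le_of_norm_le_const
    (μ := μ e) (f := fun x => f (Function.update ω e x)) (Eventually.of_forall fun x => hB _)

lemma average_sub (hf : BoundedMeasurable f) (hg : BoundedMeasurable g) (ω : ∀ i, X i) :
    average μ e (fun ω => f ω - g ω) ω = average μ e f ω - average μ e g ω :=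
  integral_sub ((hf.comp (measurable_update ω)).integrable _)
    ((hg.comp (measurable_update ω)).integrable _)

lemma integral_average (hf : BoundedMeasurable f) (e : ι) :
    ∫ ω, average μ e f ω ∂Measure.infinitePi μ = ∫ ω, f ω ∂Measure.infinitePi μ := by
  have h := measurePreserving_update μ e
  conv_rhs => rw [← h.map_eq, integral_map h.measurable.aemeasurable
    hf.measurable.aestronglyMeasurable, integral_prod _ ((hf.comp h.measurable).integrable _)]
  rfl

lemma integral_mul_sub_average_eq_zero (hf : BoundedMeasurable f) (hg : BoundedMeasurable g)
    (hge : ∀ ω x, g (Function.update ω e x) = g ω) :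
    ∫ ω, g ω * (f ω - average μ e f ω) ∂Measure.infinitePi μ = 0 := by
  rw [← integral_average (hg.mul (hf.sub (hf.average e))) e]
  refine integral_eq_zero_of_ae (Eventually.of_forall fun ω => ?_)
  have hint : Integrable (fun x => f (Function.update ω e x)) (μ e) :=
    (hf.comp (measurable_update ω)).integrable _
  simp only [average, Function.update_idem, hge, Pi.zero_apply]
  rw [integral_const_mul, integral_sub hint (integrable_const _)]
  simp

/-- Averaging is the orthogonal projection onto the functions that ignore the coordinate. -/
lemma integral_sub_sq_eq_add_integral_average_sub_sq (hf : BoundedMeasurable f)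
    (hg : BoundedMeasurable g) (hge : ∀ ω x, g (Function.update ω e x) = g ω) :
    ∫ ω, (f ω - g ω) ^ 2 ∂Measure.infinitePi μ =
      ∫ ω, (f ω - average μ e f ω) ^ 2 ∂Measure.infinitePi μ +
        ∫ ω, (average μ e f ω - g ω) ^ 2 ∂Measure.infinitePi μ := by
  have hA : BoundedMeasurable (average μ e f) := hf.average e
  have orthogonal := integral_mul_sub_average_eq_zero (μ := μ) (e := e) hf (hA.sub hg) fun ω x => by
    simp only [average, Function.update_idem, hge]
  have hexpand : ∀ ω, (f ω - g ω) ^ 2 = (f ω - average μ e f ω) ^ 2 +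
      (average μ e f ω - g ω) ^ 2 + 2 * ((average μ e f ω - g ω) * (f ω - average μ e f ω)) :=
    fun ω => by ring
  have hint₁ := (hf.sub hA).sq.integrable (Measure.infinitePi μ)
  have hint₂ := (hA.sub hg).sq.integrable (Measure.infinitePi μ)
  have hint₃ := ((hA.sub hg).mul (hf.sub hA)).integrable (Measure.infinitePi μ)
  simp only [hexpand]
  rw [integral_add (by exact hint₁.add hint₂) (hint₃.const_mul 2), integral_add hint₁ hint₂,
    integral_const_mul, orthogonal, mul_zero, add_zero]

lemma integral_average_sq_le (hf : BoundedMeasurable f) (e : ι) :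
    ∫ ω, average μ e f ω ^ 2 ∂Measure.infinitePi μ ≤ ∫ ω, f ω ^ 2 ∂Measure.infinitePi μ := by
  have h := integral_sub_sq_eq_add_integral_average_sub_sq (μ := μ) (e := e) hf
    (BoundedMeasurable.const 0) fun _ _ => rfl
  simp only [sub_zero] at h
  have hnonneg : 0 ≤ ∫ ω, (f ω - average μ e f ω) ^ 2 ∂Measure.infinitePi μ :=
    integral_nonneg fun ω => sq_nonneg _
  linarith

lemma integral_sub_average_sq_le (hf : BoundedMeasurable f) (e : ι) (x : X e) :
    ∫ ω, (f ω - average μ e f ω) ^ 2 ∂Measure.infinitePi μ ≤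
      ∫ ω, (f ω - f (Function.update ω e x)) ^ 2 ∂Measure.infinitePi μ := by
  have h := integral_sub_sq_eq_add_integral_average_sub_sq (μ := μ) hf
    (hf.comp (measurable_update_left (a := e) (x := x))) fun ω y => by rw [Function.update_idem]
  have hnonneg : 0 ≤ ∫ ω, (average μ e f ω - f (Function.update ω e x)) ^ 2
      ∂Measure.infinitePi μ := integral_nonneg fun ω => sq_nonneg _
  linarith

lemma integral_average_sub_update_sq_le (hf : BoundedMeasurable f) {i : ι} (hi : i ≠ e) (x : X i) :
    ∫ ω, (average μ e f ω - average μ e f (Function.update ω i x)) ^ 2 ∂Measure.infinitePi μ ≤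
      ∫ ω, (f ω - f (Function.update ω i x)) ^ 2 ∂Measure.infinitePi μ := by
  have hu : BoundedMeasurable fun ω => f (Function.update ω i x) :=
    hf.comp (measurable_update_left (a := i) (x := x))
  have hcomm : ∀ ω, average μ e f ω - average μ e f (Function.update ω i x) =
      average μ e (fun ω => f ω - f (Function.update ω i x)) ω := fun ω => by
    rw [average_sub hf hu]
    simp only [average, Function.update_comm hi]
  simp only [hcomm]
  exact integral_average_sq_le (hf.sub hu) e

lemma variance_eq_add_variance_average (hf : BoundedMeasurable f) (e : ι) :
    Var[f; Measure.infinitePi μ] =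
      ∫ ω, (f ω - average μ e f ω) ^ 2 ∂Measure.infinitePi μ +
        Var[average μ e f; Measure.infinitePi μ] := by
  rw [variance_eq_integral hf.measurable.aemeasurable,
    variance_eq_integral (hf.average e).measurable.aemeasurable, integral_average hf e]
  exact integral_sub_sq_eq_add_integral_average_sub_sq hf (BoundedMeasurable.const _)
    fun _ _ => rfl

theorem variance_le_sum_of_dependsOn (p : ∀ i, X i) {s : Finset ι} (hf : BoundedMeasurable f)
    (hs : DependsOn f s) :
    Var[f; Measure.infinitePi μ] ≤
      ∑ i ∈ s, ∫ ω, (f ω - f (Function.update ω i (p i))) ^ 2 ∂Measure.infinitePi μ := by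
  induction s using Finset.induction_on generalizing f with
  | empty =>
    have hconst : f = fun _ => f p := funext fun ω => hs fun i hi => by simp at hi
    rw [hconst, Finset.sum_empty, variance_eq_integral aemeasurable_const]
    simp
  | insert e s hes ih =>
    rw [variance_eq_add_variance_average hf e, Finset.sum_insert hes]
    refine add_le_add (integral_sub_average_sq_le hf e (p e)) ?_
    refine (ih (hf.average e) (dependsOn_average hs)).trans (Finset.sum_le_sum fun i hi => ?_)
    exact integral_average_sub_update_sq_le hf (ne_of_mem_of_not_mem hi hes) (p i)

lemma measurable_piecewise_left (F : Finset ι) (p : ∀ i, X i) :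
    Measurable fun ω : ∀ i, X i => F.piecewise ω p := by
  refine measurable_pi_lambda _ fun i => ?_
  by_cases hi : i ∈ F
  · simpa only [Finset.piecewise_eq_of_mem _ _ _ hi] using measurable_pi_apply i
  · simpa only [Finset.piecewise_eq_of_notMem _ _ _ hi] using measurable_const

lemma variance_piecewise_le (hf : BoundedMeasurable f) {p : ∀ i, X i} {K : ℝ}
    (hK : ∀ ω (F : Finset ι), ∑ i ∈ F, (f ω - f (Function.update ω i (p i))) ^ 2 ≤ K)
    (F : Finset ι) : Var[fun ω => f (F.piecewise ω p); Measure.infinitePi μ] ≤ K := by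
  have hfF : BoundedMeasurable fun ω => f (F.piecewise ω p) :=
    hf.comp (measurable_piecewise_left F p)
  have hdep : DependsOn (fun ω => f (F.piecewise ω p)) F := fun ω ω' h => by
    have : F.piecewise ω p = F.piecewise ω' p := F.piecewise_congr h fun _ _ => rfl
    simp only [this]
  have hinc : ∀ i ∈ F, BoundedMeasurable fun ω =>
      f (F.piecewise ω p) - f (F.piecewise (Function.update ω i (p i)) p) := fun i _ =>
    hfF.sub (hfF.comp measurable_update_left)
  calc Var[fun ω => f (F.piecewise ω p); Measure.infinitePi μ]
      ≤ ∑ i ∈ F, ∫ ω, (f (F.piecewise ω p) - f (F.piecewise (Function.update ω i (p i)) p)) ^ 2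
          ∂Measure.infinitePi μ := variance_le_sum_of_dependsOn p hfF hdep
    _ = ∫ ω, ∑ i ∈ F, (f (F.piecewise ω p) - f (F.piecewise (Function.update ω i (p i)) p)) ^ 2
          ∂Measure.infinitePi μ :=
        (integral_finsetSum _ fun i hi => (hinc i hi).sq.integrable _).symm
    _ ≤ ∫ _, K ∂Measure.infinitePi μ := by
        refine integral_mono (integrable_finsetSum _ fun i hi => (hinc i hi).sq.integrable _)
          (integrable_const _) fun ω => ?_
        refine (Finset.sum_congr rfl fun i hi => ?_).trans_le (hK (F.piecewise ω p) F)
        rw [piecewise_update F ω p hi]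
    _ = K := by simp

lemma tendsto_variance_of_bounded {Ω κ : Type*} [MeasurableSpace Ω] {P : Measure Ω}
    [IsProbabilityMeasure P] {l : Filter κ} [l.IsCountablyGenerated] {g : κ → Ω → ℝ} {h : Ω → ℝ}
    {B : ℝ} (hg : ∀ k, Measurable (g k)) (hB : ∀ k ω, |g k ω| ≤ B) (hh : BoundedMeasurable h)
    (hlim : ∀ ω, Tendsto (fun k => g k ω) l (𝓝 (h ω))) :
    Tendsto (fun k => Var[g k; P]) l (𝓝 Var[h; P]) := by
  have hgb : ∀ k, BoundedMeasurable (g k) := fun k => ⟨hg k, B, hB k⟩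
  have hmean : Tendsto (fun k => ∫ ω, g k ω ∂P) l (𝓝 (∫ ω, h ω ∂P)) :=
    tendsto_integral_filter_of_dominated_convergence (fun _ => B)
      (Eventually.of_forall fun k => (hg k).aestronglyMeasurable)
      (Eventually.of_forall fun k => Eventually.of_forall (hB k)) (integrable_const _)
      (Eventually.of_forall hlim)
  have hsq : Tendsto (fun k => ∫ ω, g k ω ^ 2 ∂P) l (𝓝 (∫ ω, h ω ^ 2 ∂P)) :=
    tendsto_integral_filter_of_dominated_convergence (fun _ => B ^ 2)
      (Eventually.of_forall fun k => ((hg k).pow_const 2).aestronglyMeasurable)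
      (Eventually.of_forall fun k => Eventually.of_forall fun ω => by
        rw [Real.norm_eq_abs, abs_pow]
        exact pow_le_pow_left₀ (abs_nonneg _) (hB k ω) 2)
      (integrable_const _) (Eventually.of_forall fun ω => (hlim ω).pow 2)
  rw [variance_eq_sub (hh.memLp 2 P)]
  simp only [variance_eq_sub ((hgb _).memLp 2 P)]
  exact hsq.sub (hmean.pow 2)

/-- The Efron–Stein inequality with each coordinate replaced by a fixed reference value instead of
an independent copy. -/
theorem variance_le_of_sum_sub_update_sq_le [Countable ι] (hf : BoundedMeasurable f)
    {p : ∀ i, X i}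
    (hlim : ∀ ω, Tendsto (fun F : Finset ι => f (F.piecewise ω p)) atTop (𝓝 (f ω))) {K : ℝ}
    (hK : ∀ ω (F : Finset ι), ∑ i ∈ F, (f ω - f (Function.update ω i (p i))) ^ 2 ≤ K) :
    Var[f; Measure.infinitePi μ] ≤ K := by
  obtain ⟨B, hB⟩ := hf.bounded
  exact le_of_tendsto (tendsto_variance_of_bounded
    (fun F => hf.measurable.comp (measurable_piecewise_left F p)) (fun F ω => hB _) hf hlim)
    (Eventually.of_forall fun F => variance_piecewise_le hf hK F)

end EfronStein

section OptimalFlow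

variable {V : Type*} {G : SimpleGraph V} [G.LocallyFinite] {a b : ℝ} {r r' q : G.edgeSet → ℝ}
  {x y : V}

/-- `q` is the square of a unit flow from `x` to `y` that has the least energy for the resistances
`r`; only the consequences that are used to compare effective resistances are recorded. -/
structure IsOptimalFlowSq (G : SimpleGraph V) [G.LocallyFinite] (r : G.edgeSet → ℝ) (x y : V)
    (q : G.edgeSet → ℝ) : Prop where
  nonneg : ∀ e, 0 ≤ q e
  hasSum : HasSum (fun e => r e * q e) (G.effectiveResistance r x y)
  effectiveResistance_le : ∀ r' : G.edgeSet → ℝ, (∀ e, 0 ≤ r' e) → ∀ E,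
    HasSum (fun e => r' e * q e) E → G.effectiveResistance r' x y ≤ E

lemma IsPotential.isOptimalFlowSq (hr : Elliptic a b r) (hG : G.Connected) (hrec : IsRecurrent G)
    (hxy : x ≠ y) {u : V → ℝ} (hu : IsPotential (fun e => (r e)⁻¹) x y u) :
    IsOptimalFlowSq G r x y fun e => ((r e)⁻¹ * grad G u e) ^ 2 where
  nonneg _ := sq_nonneg _
  hasSum := by
    rw [hu.effectiveResistance_eq hr hG hrec hxy]
    exact hu.hasSum_mul_sq hr
  effectiveResistance_le _ hr' _ hE := hu.effectiveResistance_le hxy hr' hE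

lemma Elliptic.exists_isOptimalFlowSq (hr : Elliptic a b r) (hG : G.Connected)
    (hrec : IsRecurrent G) (hxy : x ≠ y) : ∃ q, IsOptimalFlowSq G r x y q := by
  obtain ⟨u, hu⟩ := hr.inv.exists_isPotential hG x y
  exact ⟨_, hu.isOptimalFlowSq hr hG hrec hxy⟩

namespace IsOptimalFlowSq

lemma summable (hr : Elliptic a b r) (hq : IsOptimalFlowSq G r x y q) : Summable q := by
  refine Summable.of_nonneg_of_le hq.nonneg (fun e => ?_) (hq.hasSum.summable.mul_left a⁻¹)
  rw [le_inv_mul_iff₀ hr.pos]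
  exact mul_le_mul_of_nonneg_right (hr.lower e) (hq.nonneg e)

lemma summable_mul (hr : Elliptic a b r) (hr' : Elliptic a b r') (hq : IsOptimalFlowSq G r x y q) :
    Summable fun e => r' e * q e :=
  Summable.of_nonneg_of_le (fun e => mul_nonneg (hr'.pos_apply e).le (hq.nonneg e))
    (fun e => mul_le_mul_of_nonneg_right (hr'.upper e) (hq.nonneg e)) ((hq.summable hr).mul_left b)

lemma effectiveResistance_le_tsum (hr : Elliptic a b r) (hr' : Elliptic a b r')
    (hq : IsOptimalFlowSq G r x y q) : G.effectiveResistance r' x y ≤ ∑' e, r' e * q e :=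
  hq.effectiveResistance_le r' (fun e => (hr'.pos_apply e).le) _ (hq.summable_mul hr hr').hasSum

lemma mono (hr : Elliptic a b r) (hr' : Elliptic a b r') (hq : IsOptimalFlowSq G r' x y q)
    (h : ∀ e, r e ≤ r' e) : G.effectiveResistance r x y ≤ G.effectiveResistance r' x y :=
  (hq.effectiveResistance_le_tsum hr' hr).trans <|
    hasSum_le (fun e => mul_le_mul_of_nonneg_right (h e) (hq.nonneg e))
      (hq.summable_mul hr' hr).hasSum hq.hasSum

lemma effectiveResistance_nonneg (hr : Elliptic a b r) (hq : IsOptimalFlowSq G r x y q) :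
    0 ≤ G.effectiveResistance r x y :=
  hq.hasSum.nonneg fun e => mul_nonneg (hr.pos_apply e).le (hq.nonneg e)

lemma effectiveResistance_update_le [DecidableEq G.edgeSet] (hr : Elliptic a b r)
    (hq : IsOptimalFlowSq G r x y q) (e : G.edgeSet) {t : ℝ} (ht : 0 ≤ t) :
    G.effectiveResistance (Function.update r e t) x y ≤
      G.effectiveResistance r x y + (t - r e) * q e := by
  refine hq.effectiveResistance_le _ (fun i => ?_) _ ?_
  · rcases eq_or_ne i e with rfl | hi
    · simpa using ht
    · simpa [hi] using (hr.pos_apply i).le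
  · convert hq.hasSum.add (hasSum_ite_eq e ((t - r e) * q e)) using 2 with i
    rcases eq_or_ne i e with rfl | hi
    · simp only [Function.update_self, if_true]
      ring
    · simp [hi]

end IsOptimalFlowSq

end OptimalFlow

section ClampedResistance

/-- Truncation of all resistances to `[a, b]`. It makes the effective resistance a function on the
whole space of configurations that is measurable and bounded everywhere, not only almost
everywhere. -/
def clamp {ι : Type*} (a b : ℝ) (r : ι → ℝ) (i : ι) : ℝ := max a (min b (r i))

section Clamp

variable {ι : Type*} {a b : ℝ} {r : ι → ℝ}

lemma elliptic_clamp (ha : 0 < a) (hab : a ≤ b) (r : ι → ℝ) : Elliptic a b (clamp a b r) where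
  pos := ha
  le := hab
  lower _ := le_max_left _ _
  upper _ := max_le hab (min_le_left _ _)

lemma clamp_eq_self (hr : ∀ i, r i ∈ Set.Icc a b) : clamp a b r = r := funext fun i => by
  rw [clamp, min_eq_right (hr i).2, max_eq_right (hr i).1]

lemma continuous_clamp (i : ι) : Continuous fun r : ι → ℝ => clamp a b r i :=
  continuous_const.max (continuous_const.min (continuous_apply i))

lemma clamp_update [DecidableEq ι] (hab : a ≤ b) (r : ι → ℝ) (i : ι) :
    clamp a b (Function.update r i b) = Function.update (clamp a b r) i b := by
  ext j
  rcases eq_or_ne j i with rfl | hj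
  · simp [clamp, hab]
  · simp [clamp, hj]

lemma clamp_le_clamp_piecewise [DecidableEq ι] (hab : a ≤ b) (F : Finset ι) (r : ι → ℝ) (i : ι) :
    clamp a b r i ≤ clamp a b (F.piecewise r fun _ => b) i := by
  by_cases hi : i ∈ F
  · simp [clamp, hi]
  · simp [clamp, hi, hab]

lemma continuous_tsum_clamp_mul (ha : 0 < a) (hab : a ≤ b) {q : ι → ℝ}
    (hq : ∀ e, 0 ≤ q e) (hsum : Summable q) :
    Continuous fun r : ι → ℝ => ∑' e, clamp a b r e * q e := by
  refine continuous_tsum (fun e => (continuous_clamp e).mul continuous_const) (hsum.mul_left b)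
    fun e r => ?_
  have hr := elliptic_clamp ha hab r
  rw [Real.norm_of_nonneg (mul_nonneg (hr.pos_apply e).le (hq e))]
  exact mul_le_mul_of_nonneg_right (hr.upper e) (hq e)

end Clamp

lemma tendsto_piecewise {ι : Type*} [DecidableEq ι] {X : ι → Type*} [∀ i, TopologicalSpace (X i)]
    (ω p : ∀ i, X i) : Tendsto (fun F : Finset ι => F.piecewise ω p) atTop (𝓝 ω) :=
  tendsto_pi_nhds.2 fun i => tendsto_const_nhds.congr' <| by
    filter_upwards [eventually_ge_atTop {i}] with F hF
    rw [Finset.piecewise_eq_of_mem _ _ _ (hF (Finset.mem_singleton_self i))]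

variable {V : Type*} {G : SimpleGraph V} [G.LocallyFinite] {a b : ℝ} {x y : V}

/-- The effective resistance is an infimum of continuous functions of the resistances. -/
lemma upperSemicontinuous_effectiveResistance_clamp (ha : 0 < a) (hab : a ≤ b) (hG : G.Connected)
    (hrec : IsRecurrent G) (hxy : x ≠ y) :
    UpperSemicontinuous fun r => G.effectiveResistance (clamp a b r) x y := fun r t ht => by
  have hr := elliptic_clamp ha hab r
  obtain ⟨q, hq⟩ := hr.exists_isOptimalFlowSq hG hrec hxy
  have hcont := (continuous_tsum_clamp_mul ha hab hq.nonneg (hq.summable hr)).tendsto r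
  rw [hq.hasSum.tsum_eq] at hcont
  filter_upwards [hcont.eventually_lt_const ht] with r' hr'
  exact (hq.effectiveResistance_le_tsum hr (elliptic_clamp ha hab r')).trans_lt hr'

lemma tendsto_effectiveResistance_clamp_piecewise [DecidableEq G.edgeSet] (ha : 0 < a)
    (hab : a ≤ b) (hG : G.Connected) (hrec : IsRecurrent G) (hxy : x ≠ y) (r : G.edgeSet → ℝ) :
    Tendsto (fun F : Finset G.edgeSet =>
        G.effectiveResistance (clamp a b (F.piecewise r fun _ => b)) x y) atTop
      (𝓝 (G.effectiveResistance (clamp a b r) x y)) := by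
  have hr := elliptic_clamp ha hab r
  refine tendsto_order.2 ⟨fun t ht => Eventually.of_forall fun F => ht.trans_le ?_, fun t ht =>
    (tendsto_piecewise r fun _ => b).eventually
      (upperSemicontinuous_effectiveResistance_clamp ha hab hG hrec hxy r t ht)⟩
  have hF := elliptic_clamp ha hab (F.piecewise r fun _ => b)
  obtain ⟨q, hq⟩ := hF.exists_isOptimalFlowSq hG hrec hxy
  exact hq.mono hr hF (clamp_le_clamp_piecewise hab F r)

lemma sub_update_sq_le [DecidableEq G.edgeSet] (hG : G.Connected) (hrec : IsRecurrent G)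
    (hxy : x ≠ y) {r q : G.edgeSet → ℝ} (hr : Elliptic a b r) (hq : IsOptimalFlowSq G r x y q)
    (e : G.edgeSet) :
    (G.effectiveResistance r x y - G.effectiveResistance (Function.update r e b) x y) ^ 2 ≤
      (b - a) ^ 2 * q e ^ 2 := by
  have hle : ∀ i, r i ≤ Function.update r e b i := fun i => by
    rcases eq_or_ne i e with rfl | hi
    · simpa using hr.upper i
    · simp [hi]
  have hr' : Elliptic a b (Function.update r e b) :=
    ⟨hr.pos, hr.le, fun i => (hr.lower i).trans (hle i), fun i => by
      rcases eq_or_ne i e with rfl | hi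
      · simp
      · simpa [hi] using hr.upper i⟩
  obtain ⟨q', hq'⟩ := hr'.exists_isOptimalFlowSq hG hrec hxy
  have hmono := hq'.mono hr hr' hle
  have hupdate := hq.effectiveResistance_update_le hr e (hr.pos.le.trans hr.le)
  have hba : (b - r e) * q e ≤ (b - a) * q e :=
    mul_le_mul_of_nonneg_right (by linarith [hr.lower e]) (hq.nonneg e)
  rw [← mul_pow, ← neg_sq, neg_sub]
  exact pow_le_pow_left₀ (sub_nonneg.2 hmono) (by linarith) 2

variable [Countable V]

lemma boundedMeasurable_effectiveResistance_clamp (ha : 0 < a) (hab : a ≤ b) (hG : G.Connected)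
    (hrec : IsRecurrent G) (hxy : x ≠ y) :
    BoundedMeasurable fun r => G.effectiveResistance (clamp a b r) x y := by
  have hb : Elliptic a b fun _ : G.edgeSet => b := ⟨ha, hab, fun _ => hab, fun _ => le_rfl⟩
  obtain ⟨q, hq⟩ := hb.exists_isOptimalFlowSq hG hrec hxy
  refine ⟨(upperSemicontinuous_effectiveResistance_clamp ha hab hG hrec hxy).measurable,
    G.effectiveResistance (fun _ => b) x y, fun r => ?_⟩
  have hr := elliptic_clamp ha hab r
  obtain ⟨q', hq'⟩ := hr.exists_isOptimalFlowSq hG hrec hxy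
  rw [abs_of_nonneg (hq'.effectiveResistance_nonneg hr)]
  exact hq.mono hr hb hr.upper

end ClampedResistance

section RandomResistances

variable {V : Type*} [Countable V] {G : SimpleGraph V} [G.LocallyFinite] {a b : ℝ} {x y : V}
  {μ : G.edgeSet → Measure ℝ} [∀ e, IsProbabilityMeasure (μ e)]

lemma ae_forall_mem_infinitePi {ι : Type*} [Countable ι] {X : ι → Type*}
    [∀ i, MeasurableSpace (X i)] {μ : ∀ i, Measure (X i)} [∀ i, IsProbabilityMeasure (μ i)]
    {s : ∀ i, Set (X i)} (hs : ∀ i, ∀ᵐ t ∂μ i, t ∈ s i) :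
    ∀ᵐ ω ∂Measure.infinitePi μ, ∀ i, ω i ∈ s i :=
  ae_all_iff.2 fun i =>
    (measurePreserving_eval_infinitePi μ i).quasiMeasurePreserving.ae (hs i)

lemma effectiveResistance_clamp_ae_eq (hμ : ∀ e, ∀ᵐ t ∂μ e, t ∈ Set.Icc a b) :
    (fun r => G.effectiveResistance (clamp a b r) x y) =ᵐ[Measure.infinitePi μ]
      fun r => G.effectiveResistance r x y := by
  filter_upwards [ae_forall_mem_infinitePi hμ] with r hr
  rw [clamp_eq_self hr]

variable (ha : 0 < a) (hab : a ≤ b) (hG : G.Connected) (hrec : IsRecurrent G) (hxy : x ≠ y)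
  (hμ : ∀ e, ∀ᵐ t ∂μ e, t ∈ Set.Icc a b)

include ha hab hG hrec hxy hμ

theorem memLp_effectiveResistance (p : ENNReal) :
    MemLp (fun r => G.effectiveResistance r x y) p (Measure.infinitePi μ) :=
  ((boundedMeasurable_effectiveResistance_clamp ha hab hG hrec hxy).memLp p _).ae_eq
    (effectiveResistance_clamp_ae_eq hμ)

theorem variance_effectiveResistance_le {K : ℝ}
    (hK : ∀ (r : G.edgeSet → ℝ) (u : V → ℝ), Elliptic a b r →
      IsPotential (fun e => (r e)⁻¹) x y u →
        ∀ S : Finset G.edgeSet, ∑ e ∈ S, ((r e)⁻¹ * grad G u e) ^ 4 ≤ K) :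
    Var[fun r => G.effectiveResistance r x y; Measure.infinitePi μ] ≤ (b - a) ^ 2 * K := by
  classical
  rw [← variance_congr (effectiveResistance_clamp_ae_eq hμ)]
  refine variance_le_of_sum_sub_update_sq_le (p := fun _ => b)
    (boundedMeasurable_effectiveResistance_clamp ha hab hG hrec hxy)
    (tendsto_effectiveResistance_clamp_piecewise ha hab hG hrec hxy) fun r F => ?_
  have hr := elliptic_clamp ha hab r
  obtain ⟨u, hu⟩ := hr.inv.exists_isPotential hG x y
  have hq := hu.isOptimalFlowSq hr hG hrec hxy
  refine le_trans ?_ (mul_le_mul_of_nonneg_left (hK _ u hr hu F) (sq_nonneg (b - a)))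
  rw [Finset.mul_sum]
  refine Finset.sum_le_sum fun e _ => ?_
  rw [clamp_update hab]
  refine (sub_update_sq_le hG hrec hxy hr hq e).trans_eq ?_
  ring

theorem integral_effectiveResistance_mem_Icc {L U : ℝ}
    (h : ∀ (r : G.edgeSet → ℝ) (u : V → ℝ), Elliptic a b r →
      IsPotential (fun e => (r e)⁻¹) x y u → u x - u y ∈ Set.Icc L U) :
    ∫ r, G.effectiveResistance r x y ∂Measure.infinitePi μ ∈ Set.Icc L U := by
  refine (convex_Icc L U).integral_mem isClosed_Icc ?_
    (memLp_one_iff_integrable.1 (memLp_effectiveResistance ha hab hG hrec hxy hμ 1))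
  filter_upwards [ae_forall_mem_infinitePi hμ] with r hr
  have hr : Elliptic a b r := ⟨ha, hab, fun e => (hr e).1, fun e => (hr e).2⟩
  obtain ⟨u, hu⟩ := hr.inv.exists_isPotential hG x y
  rw [hu.effectiveResistance_eq hr hG hrec hxy]
  exact h r u hr hu

end RandomResistances

section Lattice

lemma l1Norm_eq_zero_iff {v : ℤ × ℤ} : l1Norm v = 0 ↔ v = 0 := by
  rw [l1Norm, Prod.ext_iff, Prod.fst_zero, Prod.snd_zero]
  omega

lemma squareLattice_adj_add {d : ℤ × ℤ} (hd : l1Norm d = 1) (z : ℤ × ℤ) :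
    squareLattice.Adj z (z + d) := by
  have h : l1Norm (z - (z + d)) = l1Norm d := by simp [l1Norm]
  exact h.trans hd

lemma reachable_add_zsmul {d : ℤ × ℤ} (hd : l1Norm d = 1) (z : ℤ × ℤ) (t : ℤ) :
    squareLattice.Reachable z (z + t • d) := by
  have step (t : ℤ) : squareLattice.Reachable (z + t • d) (z + (t + 1) • d) := by
    rw [add_one_zsmul, ← add_assoc]
    exact (squareLattice_adj_add hd _).reachable
  induction t with
  | zero => rw [zero_zsmul, add_zero]
  | succ i ih => exact ih.trans (step i)
  | pred i ih =>
    have h := step (-i - 1)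
    rw [sub_add_cancel] at h
    exact ih.trans h.symm

lemma squareLattice_connected : squareLattice.Connected where
  preconnected x y := by
    have h : x + (y - x).1 • ((1, 0) : ℤ × ℤ) + (y - x).2 • ((0, 1) : ℤ × ℤ) = y := by
      ext <;> simp
    rw [← h]
    exact (reachable_add_zsmul rfl x _).trans (reachable_add_zsmul rfl _ _)
  nonempty := inferInstance

lemma eq_of_mk_add_eq {z w d : ℤ × ℤ} (hd : d ≠ 0) (h : s(z, z + d) = s(w, w + d)) : z = w := by
  rcases Sym2.eq_iff.1 h with ⟨h, -⟩ | ⟨h, h'⟩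
  · exact h
  · rw [h, add_assoc, add_eq_left, ← two_nsmul, nsmul_eq_zero_iff] at h'
    exact absurd h' (by simpa using hd)

variable {f : ℤ × ℤ → ℝ} {d e : ℤ × ℤ} {ι : Type*}

lemma FiniteEnergy.sum_add_sub_sq_le (hf : FiniteEnergy squareLattice f) (hd : l1Norm d = 1)
    {s : Finset ι} {φ : ι → ℤ × ℤ} (hφ : Set.InjOn φ s) :
    ∑ i ∈ s, (f (φ i + d) - f (φ i)) ^ 2 ≤ energy squareLattice f := by
  have hd0 : d ≠ 0 := fun h => by simp [l1Norm_eq_zero_iff.2 h] at hd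
  exact hf.sum_sub_sq_le (fun i => squareLattice_adj_add hd (φ i))
    fun i hi j hj h => hφ hi hj (eq_of_mk_add_eq hd0 h)

lemma injective_nsmul_add_nsmul (h : d.1 * e.2 ≠ d.2 * e.1) :
    Function.Injective fun p : ℕ × ℕ => p.1 • d + p.2 • e := by
  rintro ⟨i, j⟩ ⟨i', j'⟩ hij
  simp only [Prod.ext_iff, Prod.fst_add, Prod.snd_add, Prod.smul_fst, Prod.smul_snd] at hij
  simp only [nsmul_eq_mul] at hij
  have hi : ((i : ℤ) - i') * (d.1 * e.2 - d.2 * e.1) = 0 := by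
    linear_combination e.2 * hij.1 - e.1 * hij.2
  have hj : ((j : ℤ) - j') * (d.1 * e.2 - d.2 * e.1) = 0 := by
    linear_combination d.1 * hij.2 - d.2 * hij.1
  have hi' := (mul_eq_zero.1 hi).resolve_right (sub_ne_zero.2 h)
  have hj' := (mul_eq_zero.1 hj).resolve_right (sub_ne_zero.2 h)
  exact Prod.ext (by omega) (by omega)

lemma sub_sq_le_of_sub_sq_le {p q r B : ℝ} (hpq : (p - q) ^ 2 ≤ B) (hqr : (q - r) ^ 2 ≤ B) :
    (p - r) ^ 2 ≤ 4 * B := by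
  have h := add_sq_le (a := p - q) (b := q - r)
  rw [sub_add_sub_cancel] at h
  linarith

end Lattice

section Boxes

lemma sub_sq_le_mul_sum_range (h : ℕ → ℝ) {p q n : ℕ} (hp : p ≤ n) (hq : q ≤ n) :
    (h p - h q) ^ 2 ≤ n * ∑ i ∈ Finset.range n, (h (i + 1) - h i) ^ 2 := by
  wlog hpq : p ≤ q generalizing p q
  · rw [← neg_sub, neg_sq]
    exact this hq hp (le_of_not_ge hpq)
  have hsum : |h p - h q| ≤ ∑ i ∈ Finset.range n, |h (i + 1) - h i| := by
    rw [← Real.dist_eq]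
    refine (dist_le_Ico_sum_dist h hpq).trans ?_
    simp only [Real.dist_eq, abs_sub_comm (h _) (h (_ + 1))]
    refine Finset.sum_le_sum_of_subset_of_nonneg (fun i hi => ?_) fun _ _ _ => abs_nonneg _
    exact Finset.mem_range.2 ((Finset.mem_Ico.1 hi).2.trans_le hq)
  calc (h p - h q) ^ 2 = |h p - h q| ^ 2 := (sq_abs _).symm
    _ ≤ (∑ i ∈ Finset.range n, |h (i + 1) - h i|) ^ 2 := by gcongr
    _ ≤ n * ∑ i ∈ Finset.range n, (h (i + 1) - h i) ^ 2 := by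
      simpa only [sq_abs, Finset.card_range] using
        sq_sum_le_card_mul_sum_sq (s := Finset.range n) (f := fun i => |h (i + 1) - h i|)

/-- The `ℓ^∞` norm on `ℤ²`. -/
def boxNorm (z : ℤ × ℤ) : ℕ := max z.1.natAbs z.2.natAbs

/-- The energy of `f` along the segment of length `n` which starts at `z` in the direction `d`. -/
def segmentEnergy (f : ℤ × ℤ → ℝ) (z d : ℤ × ℤ) (n : ℕ) : ℝ :=
  ∑ i ∈ Finset.range n, (f (z + (i + 1) • d) - f (z + i • d)) ^ 2

/-- The energy of `f` along the boundary of the box of radius `j` around `o`. -/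
def boundaryEnergy (f : ℤ × ℤ → ℝ) (o : ℤ × ℤ) (j : ℕ) : ℝ :=
  segmentEnergy f (o + j • (-1, -1)) (1, 0) (2 * j) +
    segmentEnergy f (o + j • (-1, 1)) (1, 0) (2 * j) +
  (segmentEnergy f (o + j • (-1, -1)) (0, 1) (2 * j) +
    segmentEnergy f (o + j • (1, -1)) (0, 1) (2 * j))

variable {f : ℤ × ℤ → ℝ} {d e : ℤ × ℤ}

lemma segmentEnergy_nonneg (f : ℤ × ℤ → ℝ) (z d : ℤ × ℤ) (n : ℕ) : 0 ≤ segmentEnergy f z d n :=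
  Finset.sum_nonneg fun _ _ => sq_nonneg _

lemma boundaryEnergy_nonneg (f : ℤ × ℤ → ℝ) (o : ℤ × ℤ) (j : ℕ) : 0 ≤ boundaryEnergy f o j := by
  have h := segmentEnergy_nonneg f
  exact add_nonneg (add_nonneg (h ..) (h ..)) (add_nonneg (h ..) (h ..))

lemma sub_sq_le_segmentEnergy (f : ℤ × ℤ → ℝ) (z d : ℤ × ℤ) {p q n : ℕ} (hp : p ≤ n) (hq : q ≤ n) :
    (f (z + p • d) - f (z + q • d)) ^ 2 ≤ n * segmentEnergy f z d n :=
  sub_sq_le_mul_sum_range (fun i => f (z + i • d)) hp hq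

lemma FiniteEnergy.sum_segmentEnergy_le (hf : FiniteEnergy squareLattice f) (hd : l1Norm d = 1)
    (hed : e.1 * d.2 ≠ e.2 * d.1) (o : ℤ × ℤ) (n : ℕ → ℕ) (s : Finset ℕ) :
    ∑ j ∈ s, segmentEnergy f (o + j • e) d (n j) ≤ energy squareLattice f := by
  simp only [segmentEnergy, succ_nsmul, ← add_assoc]
  rw [Finset.sum_sigma']
  refine hf.sum_add_sub_sq_le (φ := fun q : (_ : ℕ) × ℕ => o + q.1 • e + q.2 • d) hd ?_
  rintro ⟨j, i⟩ - ⟨j', i'⟩ - h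
  simp only [add_assoc, add_right_inj] at h
  cases injective_nsmul_add_nsmul hed (a₁ := (j, i)) (a₂ := (j', i')) h
  rfl

lemma FiniteEnergy.sum_boundaryEnergy_le (hf : FiniteEnergy squareLattice f) (o : ℤ × ℤ)
    (s : Finset ℕ) : ∑ j ∈ s, boundaryEnergy f o j ≤ 4 * energy squareLattice f := by
  have hside {d e : ℤ × ℤ} (hd : l1Norm d = 1) (hed : e.1 * d.2 ≠ e.2 * d.1) :=
    hf.sum_segmentEnergy_le hd hed o (2 * ·) s
  have h₁ := hside (d := (1, 0)) (e := (-1, -1)) rfl (by decide)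
  have h₂ := hside (d := (1, 0)) (e := (-1, 1)) rfl (by decide)
  have h₃ := hside (d := (0, 1)) (e := (-1, -1)) rfl (by decide)
  have h₄ := hside (d := (0, 1)) (e := (1, -1)) rfl (by decide)
  simp only [boundaryEnergy, Finset.sum_add_distrib]
  linarith

lemma exists_mem_side_of_boxNorm_eq {z : ℤ × ℤ} {j : ℕ} (hz : boxNorm z = j) : ∃ i ≤ 2 * j,
    z = j • (-1, -1) + i • (1, 0) ∨ z = j • (-1, 1) + i • (1, 0) ∨
      z = j • (-1, -1) + i • (0, 1) ∨ z = j • (1, -1) + i • (0, 1) := by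
  have hside : z.2 = -j ∨ z.2 = j ∨ z.1 = -j ∨ z.1 = j := by
    simp only [boxNorm] at hz
    omega
  rw [boxNorm] at hz
  rcases hside with h | h | h | h
  · exact ⟨(z.1 + j).toNat, by omega, .inl (by ext <;> simp <;> omega)⟩
  · exact ⟨(z.1 + j).toNat, by omega, .inr (.inl (by ext <;> simp <;> omega))⟩
  · exact ⟨(z.2 + j).toNat, by omega, .inr (.inr (.inl (by ext <;> simp <;> omega)))⟩
  · exact ⟨(z.2 + j).toNat, by omega, .inr (.inr (.inr (by ext <;> simp <;> omega)))⟩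

lemma sub_corner_sq_le (f : ℤ × ℤ → ℝ) (o : ℤ × ℤ) (j : ℕ) {z : ℤ × ℤ}
    (hz : boxNorm (z - o) = j) :
    (f z - f (o + j • (-1, -1))) ^ 2 ≤ 4 * j * boundaryEnergy f o j := by
  have hside (k d : ℤ × ℤ) {i : ℕ} (hi : i ≤ 2 * j) :
      (f (o + j • k + i • d) - f (o + j • k)) ^ 2 ≤
        2 * j * segmentEnergy f (o + j • k) d (2 * j) := by
    simpa using sub_sq_le_segmentEnergy f (o + j • k) d hi (Nat.zero_le _)
  have hcorner₁ : o + j • (-1, 1) = o + j • (-1, -1) + (2 * j) • (0, 1) := by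
    ext <;> simp; ring
  have hcorner₂ : o + j • (1, -1) = o + j • (-1, -1) + (2 * j) • (1, 0) := by
    ext <;> simp; ring
  have hnonneg (k d : ℤ × ℤ) : 0 ≤ 2 * (j : ℝ) * segmentEnergy f (o + j • k) d (2 * j) :=
    mul_nonneg (by positivity) (segmentEnergy_nonneg ..)
  have h₁ := hnonneg (-1, -1) (1, 0)
  have h₂ := hnonneg (-1, 1) (1, 0)
  have h₃ := hnonneg (-1, -1) (0, 1)
  have h₄ := hnonneg (1, -1) (0, 1)
  obtain ⟨i, hi, h⟩ := exists_mem_side_of_boxNorm_eq hz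
  rw [boundaryEnergy]
  rcases h with h | h | h | h <;> rw [sub_eq_iff_eq_add'.1 h, ← add_assoc]
  · linarith [hside (-1, -1) (1, 0) hi]
  · have h := add_sq_le (a := f (o + j • (-1, 1) + i • (1, 0)) - f (o + j • (-1, 1)))
      (b := f (o + j • (-1, 1)) - f (o + j • (-1, -1)))
    have h' := hside (-1, -1) (0, 1) le_rfl
    rw [← hcorner₁] at h'
    rw [sub_add_sub_cancel] at h
    linarith [hside (-1, 1) (1, 0) hi]
  · linarith [hside (-1, -1) (0, 1) hi]
  · have h := add_sq_le (a := f (o + j • (1, -1) + i • (0, 1)) - f (o + j • (1, -1)))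
      (b := f (o + j • (1, -1)) - f (o + j • (-1, -1)))
    have h' := hside (-1, -1) (1, 0) le_rfl
    rw [← hcorner₂] at h'
    rw [sub_add_sub_cancel] at h
    linarith [hside (1, -1) (0, 1) hi]

variable {m M : ℝ} {c : squareLattice.edgeSet → ℝ} {x y : ℤ × ℤ} {u : ℤ × ℤ → ℝ}

lemma boxNorm_le_add_one_of_adj {z w : ℤ × ℤ} (h : squareLattice.Adj z w) (o : ℤ × ℤ) :
    boxNorm (w - o) ≤ boxNorm (z - o) + 1 := by
  have h : l1Norm (z - w) = 1 := h
  simp only [l1Norm, boxNorm, Prod.fst_sub, Prod.snd_sub] at h ⊢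
  omega

lemma IsPotential.le_of_boxNorm_eq_le (hc : Elliptic m M c)
    (hu : IsPotential c x y u) {o : ℤ × ℤ} {j : ℕ} (hx : boxNorm (x - o) ≤ j)
    (hy : boxNorm (y - o) ≤ j) {B : ℝ} (hB : ∀ z, boxNorm (z - o) = j → u z ≤ B) {z : ℤ × ℤ}
    (hz : j < boxNorm (z - o)) : u z ≤ B := by
  refine hu.le_of_boundary_le hc squareLattice_connected (W := {z | j < boxNorm (z - o)})
    hx.not_gt hy.not_gt (fun z hz w hw hzw => hB z ?_) hz
  exact (le_of_not_gt hz).antisymm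
    (Nat.lt_succ_iff.1 (hw.trans_le (boxNorm_le_add_one_of_adj hzw o)))

lemma IsPotential.abs_sub_corner_le (hc : Elliptic m M c) (hu : IsPotential c x y u)
    {o : ℤ × ℤ} {j : ℕ} (hx : boxNorm (x - o) ≤ j) (hy : boxNorm (y - o) ≤ j) {z : ℤ × ℤ}
    (hz : j < boxNorm (z - o)) :
    |u z - u (o + j • (-1, -1))| ≤ √(4 * j * boundaryEnergy u o j) := by
  have hboundary (w : ℤ × ℤ) (hw : boxNorm (w - o) = j) :=
    Real.abs_le_sqrt (sub_corner_sq_le u o j hw)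
  have hle : u z ≤ u (o + j • (-1, -1)) + √(4 * j * boundaryEnergy u o j) :=
    hu.le_of_boxNorm_eq_le hc hx hy
      (fun w hw => sub_le_iff_le_add'.1 (abs_le.1 (hboundary w hw)).2) hz
  have hge : -u z ≤ -u (o + j • (-1, -1)) + √(4 * j * boundaryEnergy u o j) :=
    hu.neg.le_of_boxNorm_eq_le hc hy hx
      (fun w hw => by linarith [Pi.neg_apply u w, (abs_le.1 (hboundary w hw)).1]) hz
  exact abs_le.2 ⟨by linarith, by linarith⟩

-- For every `j ≤ n` the oscillation outside the box of radius `j` is at most that on its boundary;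
-- the boundaries are edge-disjoint, so summing over `j` produces the harmonic factor.
theorem IsPotential.sub_sq_mul_harmonic_le (hc : Elliptic m M c) (hu : IsPotential c x y u)
    {o : ℤ × ℤ} (hx : boxNorm (x - o) ≤ 1) (hy : boxNorm (y - o) ≤ 1) {n : ℕ} {z w : ℤ × ℤ}
    (hz : n < boxNorm (z - o)) (hw : n < boxNorm (w - o)) :
    (u z - u w) ^ 2 * harmonic n ≤ 64 * energy squareLattice u := by
  have hterm : ∀ j ∈ Finset.Icc 1 n, (u z - u w) ^ 2 * (j : ℝ)⁻¹ ≤ 16 * boundaryEnergy u o j := by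
    intro j hj
    obtain ⟨hj, hjn⟩ := Finset.mem_Icc.1 hj
    have hB : 0 ≤ 4 * j * boundaryEnergy u o j :=
      mul_nonneg (by positivity) (boundaryEnergy_nonneg u o j)
    have hcorner {z : ℤ × ℤ} (hz : n < boxNorm (z - o)) :=
      hu.abs_sub_corner_le hc (hx.trans hj) (hy.trans hj) (hjn.trans_lt hz)
    have hz' := (Real.le_sqrt (abs_nonneg _) hB).1 (hcorner hz)
    have hw' := (Real.le_sqrt (abs_nonneg _) hB).1 (hcorner hw)
    rw [abs_sub_comm] at hw'
    rw [sq_abs] at hz' hw'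
    rw [← div_eq_mul_inv, div_le_iff₀ (by positivity)]
    linarith [sub_sq_le_of_sub_sq_le hz' hw']
  rw [harmonic_eq_sum_Icc]
  push_cast
  rw [Finset.mul_sum]
  refine (Finset.sum_le_sum hterm).trans ?_
  rw [← Finset.mul_sum]
  linarith [hu.finiteEnergy.sum_boundaryEnergy_le o (Finset.Icc 1 n)]

end Boxes

section Antidiagonals

open Finset.HasAntidiagonal (antidiagonal mem_antidiagonal)

/-- The mean of `g` over the antidiagonal `{(i, j) | i + j = n}`. -/
noncomputable def antidiagonalAvg (g : ℕ × ℕ → ℝ) (n : ℕ) : ℝ :=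
  (∑ p ∈ antidiagonal n, g p) / (n + 1)

/-- The sum of the squared increments of `g` between the antidiagonals `n` and `n + 1`. -/
noncomputable def antidiagonalEnergy (g : ℕ × ℕ → ℝ) (n : ℕ) : ℝ :=
  ∑ p ∈ antidiagonal n,
    ((g (p.1 + 1, p.2) - g p) ^ 2 + (g (p.1, p.2 + 1) - g p) ^ 2)

lemma antidiagonalEnergy_nonneg (g : ℕ × ℕ → ℝ) (n : ℕ) : 0 ≤ antidiagonalEnergy g n :=
  Finset.sum_nonneg fun _ _ => add_nonneg (sq_nonneg _) (sq_nonneg _)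

lemma mul_sum_antidiagonal (g : ℕ × ℕ → ℝ) (n : ℕ) :
    n * ∑ p ∈ antidiagonal n, g p = ∑ p ∈ antidiagonal n, (p.1 * g p + p.2 * g p) := by
  rw [Finset.mul_sum]
  refine Finset.sum_congr rfl fun p hp => ?_
  rw [← mem_antidiagonal.1 hp, Nat.cast_add, add_mul]

lemma succ_mul_sum_antidiagonal_succ (g : ℕ × ℕ → ℝ) (n : ℕ) :
    (n + 1) * ∑ p ∈ antidiagonal (n + 1), g p =
      ∑ p ∈ antidiagonal n, ((p.1 + 1) * g (p.1 + 1, p.2) + (p.2 + 1) * g (p.1, p.2 + 1)) := by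
  have h := mul_sum_antidiagonal g (n + 1)
  rw [Finset.sum_add_distrib,
    Finset.Nat.sum_antidiagonal_succ (f := fun p : ℕ × ℕ => (p.1 : ℝ) * g p),
    Finset.Nat.sum_antidiagonal_succ' (f := fun p : ℕ × ℕ => (p.2 : ℝ) * g p)] at h
  simpa [Finset.sum_add_distrib] using h

lemma antidiagonalAvg_succ_sub (g : ℕ × ℕ → ℝ) (n : ℕ) :
    antidiagonalAvg g (n + 1) - antidiagonalAvg g n =
      ∑ p ∈ antidiagonal n, ((p.1 + 1) * (g (p.1 + 1, p.2) - g p) +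
        (p.2 + 1) * (g (p.1, p.2 + 1) - g p)) / ((n + 1) * (n + 2)) := by
  have havg : antidiagonalAvg g (n + 1) - antidiagonalAvg g n =
      ((n + 1) * ∑ p ∈ antidiagonal (n + 1), g p -
        (n * ∑ p ∈ antidiagonal n, g p + 2 * ∑ p ∈ antidiagonal n, g p)) /
          ((n + 1) * (n + 2)) := by
    rw [antidiagonalAvg, antidiagonalAvg, Nat.cast_add_one, add_assoc (n : ℝ), one_add_one_eq_two]
    field_simp
  rw [havg, succ_mul_sum_antidiagonal_succ, mul_sum_antidiagonal, Finset.mul_sum,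
    ← Finset.sum_add_distrib, ← Finset.sum_sub_distrib, Finset.sum_div]
  exact Finset.sum_congr rfl fun p _ => by ring

lemma antidiagonalAvg_succ_sub_sq_le (g : ℕ × ℕ → ℝ) (n : ℕ) :
    (antidiagonalAvg g (n + 1) - antidiagonalAvg g n) ^ 2 ≤
      ((n + 1 : ℕ) : ℝ)⁻¹ * antidiagonalEnergy g n := by
  rw [antidiagonalAvg_succ_sub]
  refine sq_sum_le_card_mul_sum_sq.trans ?_
  rw [Finset.Nat.card_antidiagonal, antidiagonalEnergy, Finset.mul_sum, Finset.mul_sum]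
  refine Finset.sum_le_sum fun p hp => ?_
  have hp' : (n : ℝ) = p.1 + p.2 := by exact_mod_cast (mem_antidiagonal.1 hp).symm
  have hcs (α β : ℝ) : ((p.1 + 1) * α + (p.2 + 1) * β) ^ 2 ≤ (n + 2) ^ 2 * (α ^ 2 + β ^ 2) := by
    have h : ((p.1 : ℝ) + 1) ^ 2 + (p.2 + 1) ^ 2 ≤ (n + 2) ^ 2 := by
      rw [hp']
      nlinarith [mul_nonneg (p.1.cast_nonneg (α := ℝ)) (p.2.cast_nonneg (α := ℝ))]
    have h' := mul_le_mul_of_nonneg_right h (add_nonneg (sq_nonneg α) (sq_nonneg β))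
    linarith [sq_nonneg ((p.1 + 1) * β - (p.2 + 1) * α)]
  push_cast
  rw [div_pow, mul_pow, ← mul_div_assoc, div_le_iff₀ (by positivity)]
  calc _ ≤ ((n : ℝ) + 1) * ((n + 2) ^ 2 *
          ((g (p.1 + 1, p.2) - g p) ^ 2 + (g (p.1, p.2 + 1) - g p) ^ 2)) := by
        gcongr
        exact hcs _ _
    _ = _ := by field_simp

lemma antidiagonalAvg_sub_sq_le (g : ℕ × ℕ → ℝ) (N : ℕ) :
    (antidiagonalAvg g N - g 0) ^ 2 ≤
      harmonic N * ∑ n ∈ Finset.range N, antidiagonalEnergy g n := by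
  have h0 : antidiagonalAvg g 0 = g 0 := by simp [antidiagonalAvg, Prod.mk_zero_zero]
  rw [← h0, ← Finset.sum_range_sub, harmonic]
  push_cast
  refine Finset.sum_sq_le_sum_mul_sum_of_sq_le_mul _ (fun n _ => by positivity)
    (fun n _ => antidiagonalEnergy_nonneg g n) fun n _ => ?_
  simpa only [Nat.cast_add_one] using antidiagonalAvg_succ_sub_sq_le g n

end Antidiagonals

section LogarithmicGrowth

open Finset.HasAntidiagonal (antidiagonal mem_antidiagonal)

variable {f : ℤ × ℤ → ℝ} {d e : ℤ × ℤ}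

lemma FiniteEnergy.sum_antidiagonal_sq_le (hf : FiniteEnergy squareLattice f)
    {k : ℤ × ℤ} (hk : l1Norm k = 1) (hde : d.1 * e.2 ≠ d.2 * e.1) (x : ℤ × ℤ) (N : ℕ) :
    ∑ n ∈ Finset.range N, ∑ p ∈ antidiagonal n,
      (f (x + (p.1 • d + p.2 • e) + k) - f (x + (p.1 • d + p.2 • e))) ^ 2 ≤
        energy squareLattice f := by
  rw [Finset.sum_sigma']
  refine hf.sum_add_sub_sq_le
    (φ := fun q : (_ : ℕ) × ℕ × ℕ => x + (q.2.1 • d + q.2.2 • e)) hk ?_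
  rintro ⟨n, p⟩ hp ⟨n', p'⟩ hp' h
  obtain rfl : p = p' := injective_nsmul_add_nsmul hde (add_left_cancel h)
  simp only [Finset.coe_sigma, Set.mem_sigma_iff, SetLike.mem_coe, mem_antidiagonal] at hp hp'
  rw [← hp.2, ← hp'.2]

lemma FiniteEnergy.sum_antidiagonalEnergy_le (hf : FiniteEnergy squareLattice f)
    (hd : l1Norm d = 1) (he : l1Norm e = 1) (hde : d.1 * e.2 ≠ d.2 * e.1) (x : ℤ × ℤ) (N : ℕ) :
    ∑ n ∈ Finset.range N, antidiagonalEnergy (fun p => f (x + (p.1 • d + p.2 • e))) n ≤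
      2 * energy squareLattice f := by
  have h₁ := hf.sum_antidiagonal_sq_le hd hde x N
  have h₂ := hf.sum_antidiagonal_sq_le he hde x N
  have hd' (i j : ℕ) : x + ((i + 1) • d + j • e) = x + (i • d + j • e) + d := by
    rw [succ_nsmul]; abel
  have he' (i j : ℕ) : x + (i • d + (j + 1) • e) = x + (i • d + j • e) + e := by
    rw [succ_nsmul]; abel
  simp only [antidiagonalEnergy, hd', he', Finset.sum_add_distrib]
  linarith

-- Antidiagonals of the square with opposite corners `x` and `x + N • d + N • e` are averaged
-- starting from each of the two corners; the two averages agree in the middle.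
lemma FiniteEnergy.sub_diagonal_sq_le (hf : FiniteEnergy squareLattice f)
    (hd : l1Norm d = 1) (he : l1Norm e = 1) (hde : d.1 * e.2 ≠ d.2 * e.1) (x : ℤ × ℤ) (N : ℕ) :
    (f x - f (x + N • (d + e))) ^ 2 ≤ 8 * harmonic N * energy squareLattice f := by
  have hH : (0 : ℝ) ≤ harmonic N := by
    rw [harmonic]
    push_cast
    positivity
  set y := x + N • (d + e) with hxy
  have hx := (antidiagonalAvg_sub_sq_le (fun p => f (x + (p.1 • d + p.2 • e))) N).trans
    (mul_le_mul_of_nonneg_left (hf.sum_antidiagonalEnergy_le hd he hde x N) hH)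
  have hy := (antidiagonalAvg_sub_sq_le (fun p => f (y + (p.1 • -d + p.2 • -e))) N).trans
    (mul_le_mul_of_nonneg_left (hf.sum_antidiagonalEnergy_le (d := -d) (e := -e)
      (by simpa [l1Norm] using hd) (by simpa [l1Norm] using he) (by simpa using hde) y N) hH)
  have havg : antidiagonalAvg (fun p => f (y + (p.1 • -d + p.2 • -e))) N =
      antidiagonalAvg (fun p => f (x + (p.1 • d + p.2 • e))) N := by
    rw [antidiagonalAvg, antidiagonalAvg, ← Finset.Nat.sum_antidiagonal_swap]
    congr 1
    refine Finset.sum_congr rfl fun p hp => congrArg f ?_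
    rw [hxy, ← mem_antidiagonal.1 hp]
    simp only [Prod.fst_swap, Prod.snd_swap, smul_add, add_smul, smul_neg]
    abel
  rw [havg] at hy
  simp only [Prod.fst_zero, Prod.snd_zero, zero_nsmul, add_zero] at hx hy
  rw [← neg_sub, neg_sq] at hx
  linarith [sub_sq_le_of_sub_sq_le hx hy]

lemma log_one_add_natCast_nonneg (n : ℕ) : 0 ≤ Real.log (1 + n) :=
  Real.log_nonneg (le_add_of_nonneg_right n.cast_nonneg)

lemma harmonic_le_one_add_log_of_le {N n : ℕ} (h : N ≤ n + 1) :
    (harmonic N : ℝ) ≤ 1 + Real.log (1 + n) := by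
  rcases N.eq_zero_or_pos with rfl | hN
  · rw [harmonic_zero, Rat.cast_zero]
    exact add_nonneg zero_le_one (log_one_add_natCast_nonneg n)
  · refine (harmonic_le_one_add_log N).trans ?_
    gcongr
    rw [add_comm]
    exact_mod_cast h

lemma FiniteEnergy.sub_add_zsmul_sq_le (hf : FiniteEnergy squareLattice f) (x : ℤ × ℤ) {δ : ℤ}
    (hδ : δ.natAbs = 1) {s : ℤ} {n : ℕ} (hs : s.natAbs ≤ n + 1) :
    (f x - f (x + s • (1, δ))) ^ 2 ≤ 8 * (1 + Real.log (1 + n)) * energy squareLattice f := by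
  have hdiag {ε : ℤ} (hε : ε.natAbs = 1) (hsε : s = s.natAbs * ε) :
      (f x - f (x + s • (1, δ))) ^ 2 ≤ 8 * harmonic s.natAbs * energy squareLattice f := by
    have hprod : ε * (ε * δ) ≠ 0 := by
      simp [← Int.natAbs_ne_zero, hε, hδ]
    have h := hf.sub_diagonal_sq_le (d := (ε, 0)) (e := (0, ε * δ)) (by simp [l1Norm, hε])
      (by simp [l1Norm, Int.natAbs_mul, hε, hδ]) (by simpa using hprod) x s.natAbs
    have hs' : s • ((1, δ) : ℤ × ℤ) = s.natAbs • ((ε, 0) + (0, ε * δ)) := by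
      ext
      · simpa using hsε
      · simpa [← mul_assoc] using congrArg (· * δ) hsε
    rwa [hs']
  have hle : 8 * harmonic s.natAbs * energy squareLattice f ≤
      8 * (1 + Real.log (1 + n)) * energy squareLattice f := by
    gcongr
    · exact energy_nonneg f
    · exact harmonic_le_one_add_log_of_le hs
  rcases s.natAbs_eq with h | h
  · exact (hdiag (ε := 1) rfl (by omega)).trans hle
  · exact (hdiag (ε := -1) rfl (by omega)).trans hle

lemma FiniteEnergy.sub_sq_le_of_even (hf : FiniteEnergy squareLattice f) (x : ℤ × ℤ) {p q : ℤ}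
    (hpq : Even (p + q)) {n : ℕ} (hn : p.natAbs + q.natAbs ≤ n + 1) :
    (f x - f (x + (p, q))) ^ 2 ≤ 32 * (1 + Real.log (1 + n)) * energy squareLattice f := by
  obtain ⟨s, hs⟩ := hpq
  have h₁ := hf.sub_add_zsmul_sq_le x (δ := 1) rfl (s := s) (n := n) (by omega)
  have h₂ := hf.sub_add_zsmul_sq_le (x + s • (1, 1)) (δ := -1) rfl (s := p - s) (n := n) (by omega)
  have hsum : s • ((1, 1) : ℤ × ℤ) + (p - s) • (1, -1) = (p, q) := by
    ext <;> simp; omega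
  rw [add_assoc, hsum] at h₂
  linarith [sub_sq_le_of_sub_sq_le h₁ h₂]

theorem FiniteEnergy.sub_sq_le_log (hf : FiniteEnergy squareLattice f) (x y : ℤ × ℤ) :
    (f x - f y) ^ 2 ≤ 66 * (1 + Real.log (1 + l1Norm (y - x))) * energy squareLattice f := by
  obtain ⟨⟨p, q⟩, rfl⟩ : ∃ v, y = x + v := ⟨y - x, (add_sub_cancel x y).symm⟩
  rw [add_sub_cancel_left]
  have hn : l1Norm (p, q) = p.natAbs + q.natAbs := rfl
  have hL := log_one_add_natCast_nonneg (l1Norm (p, q))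
  have hE := energy_nonneg (G := squareLattice) f
  have hLE := mul_nonneg hL hE
  rcases Int.even_or_odd (p + q) with hpq | hpq
  · linarith [hf.sub_sq_le_of_even x hpq (n := l1Norm (p, q)) (by omega)]
  · have hstep : (f (x + (1, 0)) - f x) ^ 2 ≤ energy squareLattice f := by
      simpa using hf.sum_add_sub_sq_le (d := (1, 0)) rfl (s := {x}) (φ := id)
        (Set.injOn_id _)
    have h := hf.sub_sq_le_of_even (x + (1, 0)) (p := p - 1) (q := q) (n := l1Norm (p, q))
      (by obtain ⟨s, hs⟩ := hpq; exact ⟨s, by omega⟩) (by omega)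
    have hadd : ((1, 0) : ℤ × ℤ) + (p - 1, q) = (p, q) := by ext <;> simp
    rw [add_assoc, hadd] at h
    rw [← neg_sub, neg_sq] at hstep
    have hsq := add_sq_le (a := f x - f (x + (1, 0))) (b := f (x + (1, 0)) - f (x + (p, q)))
    rw [sub_add_sub_cancel] at hsq
    linarith

end LogarithmicGrowth

section LogCutoff

lemma sum_Icc_natAbs_le {g : ℕ → ℝ} (hg : 0 ≤ g 0) (n : ℕ) :
    ∑ z ∈ Finset.Icc (-n : ℤ) n, g z.natAbs ≤ 2 * ∑ k ∈ Finset.range (n + 1), g k := by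
  induction n with
  | zero => simpa using by linarith
  | succ n ih =>
    have hIcc : Finset.Icc (-(n + 1 : ℕ) : ℤ) (n + 1 : ℕ) =
        insert (-(n + 1 : ℕ) : ℤ) (insert ((n + 1 : ℕ) : ℤ) (Finset.Icc (-n : ℤ) n)) := by
      ext z
      simp only [Finset.mem_Icc, Finset.mem_insert]
      omega
    rw [hIcc, Finset.sum_insert (by simp; omega), Finset.sum_insert (by simp),
      Finset.sum_range_succ, Int.natAbs_neg, Int.natAbs_natCast]
    linarith

lemma sum_Icc_inv_sq_le (p n : ℕ) :
    ∑ q ∈ Finset.Icc (-n : ℤ) n, (((1 + (p + q.natAbs) : ℕ) : ℝ) ^ 2)⁻¹ ≤ 4 * ((p : ℝ) + 1)⁻¹ := by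
  have hIoo : ∑ k ∈ Finset.range (n + 1), (((1 + (p + k) : ℕ) : ℝ) ^ 2)⁻¹ ≤ 2 / ((p : ℝ) + 1) := by
    refine le_trans (le_of_eq ?_) (sum_Ioo_inv_sq_le p (p + 1 + (n + 1)))
    rw [← Finset.Ico_add_one_left_eq_Ioo, Finset.sum_Ico_eq_sum_range, Nat.add_sub_cancel_left]
    exact Finset.sum_congr rfl fun k _ => by rw [add_left_comm, ← add_assoc]
  calc _ ≤ 2 * ∑ k ∈ Finset.range (n + 1), (((1 + (p + k) : ℕ) : ℝ) ^ 2)⁻¹ :=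
        sum_Icc_natAbs_le (g := fun k => (((1 + (p + k) : ℕ) : ℝ) ^ 2)⁻¹) (by positivity) n
    _ ≤ 2 * (2 / ((p : ℝ) + 1)) := by gcongr
    _ = 4 * ((p : ℝ) + 1)⁻¹ := by ring

lemma sum_box_inv_sq_le (n : ℕ) :
    ∑ z ∈ Finset.Icc (-n : ℤ) n ×ˢ Finset.Icc (-n : ℤ) n, (((1 + l1Norm z : ℕ) : ℝ) ^ 2)⁻¹ ≤
      8 * (1 + Real.log (1 + n)) := by
  rw [Finset.sum_product]
  calc ∑ p ∈ Finset.Icc (-n : ℤ) n, ∑ q ∈ Finset.Icc (-n : ℤ) n,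
        (((1 + l1Norm (p, q) : ℕ) : ℝ) ^ 2)⁻¹
      ≤ ∑ p ∈ Finset.Icc (-n : ℤ) n, 4 * ((p.natAbs : ℝ) + 1)⁻¹ :=
        Finset.sum_le_sum fun p _ => sum_Icc_inv_sq_le p.natAbs n
    _ ≤ 2 * ∑ k ∈ Finset.range (n + 1), 4 * ((k : ℝ) + 1)⁻¹ :=
        sum_Icc_natAbs_le (g := fun k => 4 * ((k : ℝ) + 1)⁻¹) (by positivity) n
    _ = 8 * harmonic (n + 1) := by
        rw [← Finset.mul_sum, harmonic]
        push_cast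
        ring
    _ ≤ 8 * (1 + Real.log (1 + n)) := by
        gcongr
        exact harmonic_le_one_add_log_of_le le_rfl

lemma exists_eq_mk_add (e : squareLattice.edgeSet) :
    ∃ p : (ℤ × ℤ) × Fin 2, e.1 = s(p.1, p.1 + ![(1, 0), (0, 1)] p.2) := by
  obtain ⟨e, he⟩ := e
  induction e with
  | h x y =>
    have h : (x.1 - y.1).natAbs + (x.2 - y.2).natAbs = 1 := he
    obtain h | h | h | h : (y.1 = x.1 + 1 ∧ y.2 = x.2) ∨ (y.1 = x.1 ∧ y.2 = x.2 + 1) ∨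
        (x.1 = y.1 + 1 ∧ x.2 = y.2) ∨ (x.1 = y.1 ∧ x.2 = y.2 + 1) := by omega
    · exact ⟨(x, 0), by simp [Prod.ext_iff, h.1, h.2]⟩
    · exact ⟨(x, 1), by simp [Prod.ext_iff, h.1, h.2]⟩
    · exact ⟨(y, 0), by simp [Prod.ext_iff, h.1, h.2]⟩
    · exact ⟨(y, 1), by simp [Prod.ext_iff, h.1, h.2]⟩

lemma energy_le_sum {f : ℤ × ℤ → ℝ} {T : Finset (ℤ × ℤ)}
    (hT : ∀ z ∉ T, ∀ d, l1Norm d = 1 → f (z + d) = f z) :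
    energy squareLattice f ≤
      ∑ z ∈ T, ((f (z + (1, 0)) - f z) ^ 2 + (f (z + (0, 1)) - f z) ^ 2) := by
  choose φ hφ using exists_eq_mk_add
  set g : (ℤ × ℤ) × Fin 2 → ℝ := fun p => (f (p.1 + ![(1, 0), (0, 1)] p.2) - f p.1) ^ 2
  have hinj : Function.Injective φ := fun e e' h => Subtype.ext (by rw [hφ e, hφ e', h])
  have hgrad (e : squareLattice.edgeSet) : grad squareLattice f e ^ 2 = g (φ e) := by
    obtain ⟨e, he⟩ := e
    have h : e = s((φ ⟨e, he⟩).1, (φ ⟨e, he⟩).1 + ![(1, 0), (0, 1)] (φ ⟨e, he⟩).2) :=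
      hφ ⟨e, he⟩
    generalize φ ⟨e, he⟩ = p at h
    subst h
    exact grad_sq_mk f _
  have hg (p : (ℤ × ℤ) × Fin 2) (hp : p ∉ T ×ˢ Finset.univ) : g p = 0 := by
    have hstep : l1Norm (![(1, 0), (0, 1)] p.2) = 1 := by
      rcases p with ⟨z, i⟩
      fin_cases i <;> rfl
    have hpT : p.1 ∉ T := fun h => hp (Finset.mem_product.2 ⟨h, Finset.mem_univ _⟩)
    exact pow_eq_zero_iff two_ne_zero |>.2 (sub_eq_zero.2 (hT p.1 hpT _ hstep))
  have hsummable : Summable g := summable_of_ne_finset_zero hg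
  calc energy squareLattice f = ∑' e, g (φ e) := tsum_congr hgrad
    _ ≤ ∑' p, g p := (hsummable.comp_injective hinj).tsum_le_tsum_of_inj φ hinj
        (fun _ _ => sq_nonneg _) (fun _ => le_rfl) hsummable
    _ = _ := by
      rw [tsum_eq_sum hg, Finset.sum_product]
      simp only [Fin.sum_univ_two, Matrix.cons_val_zero, Matrix.cons_val_one, g]

/-- The logarithmic cutoff at distance `n` from the origin: it decreases from `1` at the origin to
`0` outside the `ℓ¹` ball of radius `n`, and its energy is of order `1 / log n`. -/
noncomputable def logCutoff (n : ℕ) (z : ℤ × ℤ) : ℝ :=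
  max (1 - Real.log (1 + l1Norm z) / Real.log (1 + n)) 0

lemma logCutoff_zero (n : ℕ) : logCutoff n 0 = 1 := by
  simp [logCutoff, l1Norm]

lemma log_one_add_natCast_pos {n : ℕ} (hn : 1 ≤ n) : 0 < Real.log (1 + n) :=
  Real.log_pos (by have : (1 : ℝ) ≤ n := mod_cast hn; linarith)

lemma one_le_log_one_add_natCast {n : ℕ} (hn : 2 ≤ n) : 1 ≤ Real.log (1 + n) := by
  have h : (2 : ℝ) ≤ n := mod_cast hn
  rw [Real.le_log_iff_exp_le (by positivity)]
  linarith [Real.exp_one_lt_three]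

lemma logCutoff_eq_zero {n : ℕ} (hn : 1 ≤ n) {z : ℤ × ℤ} (hz : n ≤ l1Norm z) :
    logCutoff n z = 0 := by
  refine max_eq_right (sub_nonpos.2 ((one_le_div (log_one_add_natCast_pos hn)).2 ?_))
  gcongr

lemma abs_logCutoff_le_one (n : ℕ) (z : ℤ × ℤ) : |logCutoff n z| ≤ 1 := by
  have h := div_nonneg (log_one_add_natCast_nonneg (l1Norm z)) (log_one_add_natCast_nonneg n)
  rw [logCutoff, abs_of_nonneg (le_max_right _ _)]
  exact max_le (by linarith) zero_le_one

lemma tendsto_log_one_add_natCast : Tendsto (fun n : ℕ => Real.log (1 + n)) atTop atTop :=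
  Real.tendsto_log_atTop.comp (tendsto_atTop_add_const_left _ _ tendsto_natCast_atTop_atTop)

lemma tendsto_logCutoff (z : ℤ × ℤ) : Tendsto (fun n => logCutoff n z) atTop (𝓝 1) := by
  have h := (tendsto_log_one_add_natCast.const_div_atTop (Real.log (1 + l1Norm z))).const_sub 1
  simpa [logCutoff] using h.max (tendsto_const_nhds (x := (0 : ℝ)))

lemma log_one_add_sub_le {k l : ℕ} : Real.log (1 + k) - Real.log (1 + l) ≤ (k - l) / (1 + l) := by
  rw [← Real.log_div (by positivity) (by positivity)]
  refine (Real.log_le_sub_one_of_pos (by positivity)).trans (le_of_eq ?_)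
  field_simp
  ring

lemma abs_log_one_add_sub_le {k l : ℕ} (hkl : k ≤ l + 1) (hlk : l ≤ k + 1) :
    |Real.log (1 + k) - Real.log (1 + l)| ≤ 2 / (1 + l) := by
  have hkl' : (k : ℝ) ≤ l + 1 := mod_cast hkl
  have hlk' : (l : ℝ) ≤ k + 1 := mod_cast hlk
  refine abs_sub_le_iff.2 ⟨log_one_add_sub_le.trans ?_, log_one_add_sub_le.trans ?_⟩
  · gcongr
    linarith
  · rw [div_le_div_iff₀ (by positivity) (by positivity)]
    nlinarith

lemma logCutoff_step_sq_le (n : ℕ) (z : ℤ × ℤ) {d : ℤ × ℤ} (hd : l1Norm d = 1) :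
    (logCutoff n (z + d) - logCutoff n z) ^ 2 ≤
      4 / Real.log (1 + n) ^ 2 * (((1 + l1Norm z : ℕ) : ℝ) ^ 2)⁻¹ := by
  have hk : l1Norm (z + d) ≤ l1Norm z + 1 ∧ l1Norm z ≤ l1Norm (z + d) + 1 := by
    simp only [l1Norm, Prod.fst_add, Prod.snd_add] at *
    omega
  have habs : |logCutoff n (z + d) - logCutoff n z| ≤
      2 / (1 + l1Norm z) / Real.log (1 + n) := by
    refine (abs_max_sub_max_le_abs _ _ _).trans ?_
    rw [sub_sub_sub_cancel_left, ← sub_div, abs_div, abs_sub_comm,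
      abs_of_nonneg (log_one_add_natCast_nonneg n)]
    exact div_le_div_of_nonneg_right (abs_log_one_add_sub_le hk.1 hk.2)
      (log_one_add_natCast_nonneg n)
  calc _ = |logCutoff n (z + d) - logCutoff n z| ^ 2 := (sq_abs _).symm
    _ ≤ (2 / (1 + l1Norm z) / Real.log (1 + n)) ^ 2 := by gcongr
    _ = _ := by push_cast; field_simp; norm_num

lemma le_l1Norm_of_notMem_box {n : ℕ} {z : ℤ × ℤ}
    (hz : z ∉ Finset.Icc (-n : ℤ) n ×ˢ Finset.Icc (-n : ℤ) n) : n + 1 ≤ l1Norm z := by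
  simp only [Finset.mem_product, Finset.mem_Icc, l1Norm] at *
  omega

lemma exists_finsupp_eq_logCutoff {n : ℕ} (hn : 1 ≤ n) :
    ∃ η : (ℤ × ℤ) →₀ ℝ, ⇑η = logCutoff n :=
  ⟨.onFinset (Finset.Icc (-n : ℤ) n ×ˢ Finset.Icc (-n : ℤ) n) (logCutoff n) fun z hz => by
    contrapose! hz
    exact logCutoff_eq_zero hn (Nat.le_of_succ_le (le_l1Norm_of_notMem_box hz)), rfl⟩

lemma finiteEnergy_logCutoff {n : ℕ} (hn : 1 ≤ n) : FiniteEnergy squareLattice (logCutoff n) := by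
  obtain ⟨η, hη⟩ := exists_finsupp_eq_logCutoff hn
  exact hη ▸ finiteEnergy_finsupp η

theorem energy_logCutoff_le {n : ℕ} (hn : 2 ≤ n) :
    energy squareLattice (logCutoff n) ≤ 128 / Real.log (1 + n) := by
  have hlog := one_le_log_one_add_natCast hn
  have hT (z : ℤ × ℤ) (hz : z ∉ Finset.Icc (-n : ℤ) n ×ˢ Finset.Icc (-n : ℤ) n) (d : ℤ × ℤ)
      (hd : l1Norm d = 1) : logCutoff n (z + d) = logCutoff n z := by
    have hzn := le_l1Norm_of_notMem_box hz
    have hzd : n ≤ l1Norm (z + d) := by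
      simp only [l1Norm, Prod.fst_add, Prod.snd_add] at *
      omega
    rw [logCutoff_eq_zero (by omega) hzd, logCutoff_eq_zero (by omega) (by omega)]
  calc energy squareLattice (logCutoff n)
      ≤ ∑ z ∈ Finset.Icc (-n : ℤ) n ×ˢ Finset.Icc (-n : ℤ) n,
          8 / Real.log (1 + n) ^ 2 * (((1 + l1Norm z : ℕ) : ℝ) ^ 2)⁻¹ :=
        (energy_le_sum hT).trans (Finset.sum_le_sum fun z _ =>
          (add_le_add (logCutoff_step_sq_le n z rfl) (logCutoff_step_sq_le n z rfl)).trans_eq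
            (by ring))
    _ ≤ 8 / Real.log (1 + n) ^ 2 * (8 * (1 + Real.log (1 + n))) := by
        rw [← Finset.mul_sum]
        gcongr
        exact sum_box_inv_sq_le n
    _ ≤ 128 / Real.log (1 + n) := by
        field_simp
        linarith

theorem squareLattice_isRecurrent : IsRecurrent squareLattice := by
  choose η hη using fun n => exists_finsupp_eq_logCutoff (n := n + 2) (by omega)
  have hlim {g : ℕ → ℝ} {l : ℝ} (h : Tendsto g atTop (𝓝 l)) :
      Tendsto (fun n => g (n + 2)) atTop (𝓝 l) := h.comp (tendsto_add_atTop_nat 2)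
  refine ⟨η, fun n z => hη n ▸ abs_logCutoff_le_one _ _, fun z => ?_, ?_⟩
  · simpa only [hη] using hlim (tendsto_logCutoff z)
  · simp only [hη]
    exact squeeze_zero (fun _ => energy_nonneg _) (fun n => energy_logCutoff_le (by omega))
      (hlim (tendsto_log_one_add_natCast.const_div_atTop 128))

end LogCutoff

section PotentialEstimates

variable {m M : ℝ} {c : squareLattice.edgeSet → ℝ} {x y z t : ℤ × ℤ} {u : ℤ × ℤ → ℝ}

lemma le_of_sq_le_mul {p q : ℝ} (hp : 0 ≤ p) (hq : 0 ≤ q) (h : p ^ 2 ≤ q * p) : p ≤ q := by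
  rcases hp.eq_or_lt with rfl | hp
  · exact hq
  · exact le_of_mul_le_mul_right (by rwa [← sq]) hp

theorem IsPotential.sub_le_log (hc : Elliptic m M c) (hu : IsPotential c x y u) :
    u x - u y ≤ 66 / m * (1 + Real.log (1 + l1Norm (y - x))) := by
  have hm := hc.pos
  have hL := log_one_add_natCast_nonneg (l1Norm (y - x))
  refine le_of_sq_le_mul (sub_nonneg.2 (hu.sink_le_source hc)) (by positivity) ?_
  calc (u x - u y) ^ 2
      ≤ 66 * (1 + Real.log (1 + l1Norm (y - x))) * energy squareLattice u :=
        hu.finiteEnergy.sub_sq_le_log x y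
    _ ≤ 66 * (1 + Real.log (1 + l1Norm (y - x))) * ((u x - u y) / m) := by
        gcongr
        exact hu.energy_le hc
    _ = _ := by ring

theorem IsPotential.log_le_sub (hc : Elliptic m M c) (hu : IsPotential c 0 y u)
    (hy : 2 ≤ l1Norm y) : Real.log (1 + l1Norm y) / (128 * M) ≤ u 0 - u y := by
  have hM := hc.pos.trans_le hc.le
  have hlog := log_one_add_natCast_pos (one_le_two.trans hy)
  have h := hu.sub_sq_le hc (finiteEnergy_logCutoff (one_le_two.trans hy))
  rw [logCutoff_zero, logCutoff_eq_zero (one_le_two.trans hy) le_rfl, sub_zero, one_pow] at h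
  have hub : 1 ≤ (u 0 - u y) * (M * (128 / Real.log (1 + l1Norm y))) :=
    h.trans (mul_le_mul_of_nonneg_left
      (mul_le_mul_of_nonneg_left (energy_logCutoff_le hy) hM.le)
      (sub_nonneg.2 (hu.sink_le_source hc)))
  field_simp at hub
  rw [div_le_iff₀ (by positivity)]
  linarith

lemma log_one_add_le_harmonic (n : ℕ) : Real.log (1 + n) ≤ harmonic n := by
  simpa [add_comm] using log_add_one_le_harmonic n

lemma IsPotential.sub_sq_le_div_log (hc : Elliptic m M c) (hu : IsPotential c x y u)
    (h : squareLattice.Adj z t) {n : ℕ} (hn : 1 ≤ n) (hx : n < boxNorm (x - z))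
    (hy : n < boxNorm (y - z)) :
    (u z - u t) ^ 2 ≤ 64 / (m ^ 2 * Real.log (1 + n)) := by
  have hlog := log_one_add_natCast_pos hn
  obtain ⟨w, hw⟩ := hc.exists_isPotential squareLattice_connected z t
  have hz : boxNorm (z - z) ≤ 0 := by simp [boxNorm]
  have ht : boxNorm (t - z) ≤ 1 := (boxNorm_le_add_one_of_adj h z).trans (Nat.succ_le_succ hz)
  have key : (w x - w y) ^ 2 * Real.log (1 + n) ≤ 64 * (1 / m ^ 2) :=
    calc (w x - w y) ^ 2 * Real.log (1 + n) ≤ (w x - w y) ^ 2 * harmonic n := by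
          gcongr
          exact log_one_add_le_harmonic n
      _ ≤ 64 * energy squareLattice w :=
          hw.sub_sq_mul_harmonic_le hc (hz.trans zero_le_one) ht hx hy
      _ ≤ 64 * (1 / m ^ 2) := by
          gcongr
          exact hw.energy_le_of_adj hc h
  rw [hu.reciprocity hw, ← div_div, le_div_iff₀ hlog]
  exact key.trans_eq (by ring)

lemma IsPotential.sum_grad_sq_near_source_le (hc : Elliptic m M c) (hu : IsPotential c x y u)
    {n : ℕ} {s : Finset squareLattice.edgeSet} (hs : ∀ e ∈ s, ∃ z ∈ e.1, boxNorm (x - z) ≤ n) :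
    ∑ e ∈ s, grad squareLattice u e ^ 2 ≤ 66 / m ^ 2 * (2 + Real.log (1 + n)) := by
  have hm := hc.pos
  have hL := log_one_add_natCast_nonneg n
  have hball (z : ℤ × ℤ) (hz : l1Norm (z - x) ≤ 2 * n + 1) :
      u x - 66 / m * (2 + Real.log (1 + n)) ≤ u z := by
    obtain ⟨w, hw⟩ := hc.exists_isPotential squareLattice_connected x z
    have hlog : Real.log (1 + l1Norm (z - x)) ≤ 1 + Real.log (1 + n) := by
      have hz' : (l1Norm (z - x) : ℝ) ≤ 2 * n + 1 := mod_cast hz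
      calc Real.log (1 + l1Norm (z - x)) ≤ Real.log (2 * (1 + n)) :=
            Real.log_le_log (by positivity) (by linarith)
        _ = Real.log 2 + Real.log (1 + n) := Real.log_mul two_ne_zero (by positivity)
        _ ≤ _ := by linarith [Real.log_two_lt_d9]
    have hle : 66 / m * (1 + Real.log (1 + l1Norm (z - x))) ≤
        66 / m * (2 + Real.log (1 + n)) :=
      mul_le_mul_of_nonneg_left (by linarith) (by positivity)
    linarith [hu.source_sub_le hc squareLattice_connected hw, hw.sub_le_log hc]
  have h := hu.sum_grad_sq_le_of_superlevel hc (B := 66 / m * (2 + Real.log (1 + n)))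
    (by positivity) (s := s) fun e he z hz => hball z ?_
  · exact h.trans_eq (by field_simp)
  · obtain ⟨w, hw, hwn⟩ := hs e he
    have hzw : l1Norm (z - w) ≤ 1 := by
      by_cases hne : w = z
      · simp [hne, l1Norm]
      · have h : squareLattice.Adj z w := SimpleGraph.adj_iff_exists_edge_coe.2
          ⟨e, (Sym2.mem_and_mem_iff (Ne.symm hne)).1 ⟨hz, hw⟩⟩
        exact le_of_eq h
    simp only [l1Norm, boxNorm, Prod.fst_sub, Prod.snd_sub] at *
    omega

lemma sum_pow_four_le_mul {ι : Type*} {g : ι → ℝ} {s : Finset ι} {A B : ℝ} (hA : 0 ≤ A)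
    (hg : ∀ i ∈ s, g i ^ 2 ≤ A) (hs : ∑ i ∈ s, g i ^ 2 ≤ B) : ∑ i ∈ s, g i ^ 4 ≤ A * B :=
  calc ∑ i ∈ s, g i ^ 4 ≤ ∑ i ∈ s, A * g i ^ 2 := Finset.sum_le_sum fun i hi => by
        rw [show g i ^ 4 = g i ^ 2 * g i ^ 2 by ring]
        exact mul_le_mul_of_nonneg_right (hg i hi) (sq_nonneg _)
    _ ≤ A * B := by
        rw [← Finset.mul_sum]
        exact mul_le_mul_of_nonneg_left hs hA

lemma IsPotential.sum_grad_pow_four_near_source_le (hc : Elliptic m M c)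
    (hu : IsPotential c x y u) {n : ℕ} {s : Finset squareLattice.edgeSet}
    (hs : ∀ e ∈ s, ∃ z ∈ e.1, boxNorm (x - z) ≤ n) :
    ∑ e ∈ s, grad squareLattice u e ^ 4 ≤ 66 / m ^ 4 * (2 + Real.log (1 + n)) := by
  have hm := hc.pos
  exact (sum_pow_four_le_mul (by positivity) (fun e _ => hu.grad_sq_le hc squareLattice_connected e)
    (hu.sum_grad_sq_near_source_le hc hs)).trans_eq (by field_simp)

lemma IsPotential.sum_grad_pow_four_far_le (hc : Elliptic m M c) (hu : IsPotential c x y u)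
    {n : ℕ} (hn : 1 ≤ n) {s : Finset squareLattice.edgeSet}
    (hx : ∀ e ∈ s, ∀ z ∈ e.1, n < boxNorm (x - z))
    (hy : ∀ e ∈ s, ∀ z ∈ e.1, n < boxNorm (y - z)) :
    ∑ e ∈ s, grad squareLattice u e ^ 4 ≤
      4224 / m ^ 4 * ((1 + Real.log (1 + l1Norm (y - x))) / Real.log (1 + n)) := by
  have hm := hc.pos
  have hlog := log_one_add_natCast_pos hn
  have hgrad (e : squareLattice.edgeSet) (hes : e ∈ s) :
      grad squareLattice u e ^ 2 ≤ 64 / (m ^ 2 * Real.log (1 + n)) := by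
    obtain ⟨e, he⟩ := e
    induction e with
    | h z t =>
      rw [grad_sq_mk u he]
      exact hu.sub_sq_le_div_log hc he.symm hn (hx _ hes _ (Sym2.mem_mk_right z t))
        (hy _ hes _ (Sym2.mem_mk_right z t))
  have henergy : ∑ e ∈ s, grad squareLattice u e ^ 2 ≤
      66 / m * (1 + Real.log (1 + l1Norm (y - x))) / m :=
    calc _ ≤ energy squareLattice u := hu.finiteEnergy.sum_grad_sq_le s
      _ ≤ (u x - u y) / m := hu.energy_le hc
      _ ≤ _ := div_le_div_of_nonneg_right (hu.sub_le_log hc) hm.le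
  refine (sum_pow_four_le_mul (by positivity) hgrad henergy).trans_eq ?_
  field_simp
  ring

lemma IsPotential.sum_grad_pow_four_le_of_radius (hc : Elliptic m M c)
    (hu : IsPotential c x y u) (s : Finset squareLattice.edgeSet) {n : ℕ} (hn : 1 ≤ n) :
    ∑ e ∈ s, grad squareLattice u e ^ 4 ≤ 132 / m ^ 4 * (2 + Real.log (1 + n)) +
      4224 / m ^ 4 * ((1 + Real.log (1 + l1Norm (y - x))) / Real.log (1 + n)) := by
  classical
  let near (o : ℤ × ℤ) (e : squareLattice.edgeSet) : Prop := ∃ z ∈ e.1, boxNorm (o - z) ≤ n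
  have hsource := hu.sum_grad_pow_four_near_source_le hc (n := n) (s := {e ∈ s | near x e})
    fun e he => (Finset.mem_filter.1 he).2
  have hsink := hu.neg.sum_grad_pow_four_near_source_le hc (n := n)
    (s := {e ∈ {e ∈ s | ¬ near x e} | near y e}) fun e he => (Finset.mem_filter.1 he).2
  have hfar := hu.sum_grad_pow_four_far_le hc hn (s := {e ∈ {e ∈ s | ¬ near x e} | ¬ near y e})
    (fun e he z hz => by
      by_contra! h
      exact (Finset.mem_filter.1 (Finset.mem_filter.1 he).1).2 ⟨z, hz, h⟩)
    (fun e he z hz => by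
      by_contra! h
      exact (Finset.mem_filter.1 he).2 ⟨z, hz, h⟩)
  simp only [map_neg, Pi.neg_apply, Even.neg_pow (by decide : Even 4)] at hsink
  rw [← Finset.sum_filter_add_sum_filter_not s (near x),
    ← Finset.sum_filter_add_sum_filter_not {e ∈ s | ¬ near x e} (near y)]
  linarith [show 132 / m ^ 4 * (2 + Real.log (1 + n)) = 2 * (66 / m ^ 4 * (2 + Real.log (1 + n)))
    by ring]

lemma exists_natCast_log_mem_Icc {s : ℝ} (hs : 0 ≤ s) :
    ∃ n : ℕ, 1 ≤ n ∧ Real.log (1 + n) ∈ Set.Icc s (1 + s) := by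
  have hexp : 1 ≤ Real.exp s := Real.one_le_exp hs
  refine ⟨⌊Real.exp s⌋₊, Nat.le_floor (mod_cast hexp), ?_, ?_⟩
  · rw [Real.le_log_iff_exp_le (by positivity), add_comm]
    exact (Nat.lt_floor_add_one _).le
  · rw [Real.log_le_iff_le_exp (by positivity), Real.exp_add]
    nlinarith [Real.exp_one_gt_d9, Nat.floor_le (Real.exp_pos s).le]

-- The radius with `log n ≈ √(log |y - x|)` balances the contributions near and far from the poles.
theorem IsPotential.sum_grad_pow_four_le (hc : Elliptic m M c) (hu : IsPotential c x y u)
    (s : Finset squareLattice.edgeSet) : ∑ e ∈ s, grad squareLattice u e ^ 4 ≤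
      4752 / m ^ 4 * √(1 + Real.log (1 + l1Norm (y - x))) := by
  have hm := hc.pos
  set L := 1 + Real.log (1 + (l1Norm (y - x) : ℝ))
  have hL : 1 ≤ L := le_add_of_nonneg_right (log_one_add_natCast_nonneg _)
  have hsqrt : 1 ≤ √L := Real.one_le_sqrt.2 hL
  obtain ⟨n, hn, hlo, hhi⟩ := exists_natCast_log_mem_Icc (Real.sqrt_nonneg L)
  have hfar : L / Real.log (1 + n) ≤ √L := by
    rw [div_le_iff₀ (by linarith)]
    calc L = √L * √L := (Real.mul_self_sqrt (by linarith)).symm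
      _ ≤ _ := by gcongr
  calc ∑ e ∈ s, grad squareLattice u e ^ 4
      ≤ 132 / m ^ 4 * (2 + Real.log (1 + n)) + 4224 / m ^ 4 * (L / Real.log (1 + n)) :=
        hu.sum_grad_pow_four_le_of_radius hc s hn
    _ ≤ 132 / m ^ 4 * (4 * √L) + 4224 / m ^ 4 * √L := by
        gcongr
        linarith
    _ = 4752 / m ^ 4 * √L := by ring

end PotentialEstimates

section RandomResistancesOnTheLattice

variable {a b : ℝ} {x y v : ℤ × ℤ} {μ : squareLattice.edgeSet → Measure ℝ}
  [∀ e, IsProbabilityMeasure (μ e)]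

theorem variance_effectiveResistance_squareLattice_le (ha : 0 < a) (hab : a ≤ b) (hxy : x ≠ y)
    (hμ : ∀ e, ∀ᵐ t ∂μ e, t ∈ Set.Icc a b) :
    Var[fun r => squareLattice.effectiveResistance r x y; Measure.infinitePi μ] ≤
      4752 * (b - a) ^ 2 * b ^ 4 / a ^ 4 * √(1 + Real.log (1 + l1Norm (y - x))) := by
  refine (variance_effectiveResistance_le ha hab squareLattice_connected
    squareLattice_isRecurrent hxy hμ
    (K := b ^ 4 / a ^ 4 * (4752 * √(1 + Real.log (1 + l1Norm (y - x)))))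
    fun r u hr hu s => ?_).trans_eq ?_
  · calc ∑ e ∈ s, ((r e)⁻¹ * grad squareLattice u e) ^ 4
        ≤ ∑ e ∈ s, a⁻¹ ^ 4 * grad squareLattice u e ^ 4 := Finset.sum_le_sum fun e _ => by
          rw [mul_pow]
          exact mul_le_mul_of_nonneg_right
            (pow_le_pow_left₀ (hr.inv.pos_apply e).le (hr.inv.upper e) 4) (by positivity)
      _ ≤ a⁻¹ ^ 4 * (4752 / b⁻¹ ^ 4 * √(1 + Real.log (1 + l1Norm (y - x)))) := by
          rw [← Finset.mul_sum]
          gcongr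
          exact hu.sum_grad_pow_four_le hr.inv s
      _ = _ := by field_simp
  · ring

theorem integral_effectiveResistance_le_log (ha : 0 < a) (hab : a ≤ b) (hxy : x ≠ y)
    (hμ : ∀ e, ∀ᵐ t ∂μ e, t ∈ Set.Icc a b) :
    ∫ r, squareLattice.effectiveResistance r x y ∂Measure.infinitePi μ ≤
      66 * b * (1 + Real.log (1 + l1Norm (y - x))) := by
  refine (integral_effectiveResistance_mem_Icc ha hab squareLattice_connected
    squareLattice_isRecurrent hxy hμ (L := 0) fun r u hr hu => ⟨?_, ?_⟩).2
  · exact sub_nonneg.2 (hu.sink_le_source hr.inv)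
  · simpa using hu.sub_le_log hr.inv

theorem log_le_integral_effectiveResistance (ha : 0 < a) (hab : a ≤ b) (hv : 2 ≤ l1Norm v)
    (hμ : ∀ e, ∀ᵐ t ∂μ e, t ∈ Set.Icc a b) :
    a / 128 * Real.log (1 + l1Norm v) ≤
      ∫ r, squareLattice.effectiveResistance r 0 v ∂Measure.infinitePi μ := by
  have hv₀ : 0 ≠ v := by
    rintro rfl
    simp [l1Norm] at hv
  refine (integral_effectiveResistance_mem_Icc ha hab squareLattice_connected
    squareLattice_isRecurrent hv₀ hμ fun r u hr hu => ⟨?_, hu.sub_le_log hr.inv⟩).1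
  refine le_trans (le_of_eq ?_) (hu.log_le_sub hr.inv hv)
  field_simp

end RandomResistancesOnTheLattice

lemma one_le_log_natCast {n : ℕ} (hn : 3 ≤ n) : 1 ≤ Real.log n := by
  have hn' : (3 : ℝ) ≤ n := mod_cast hn
  rw [Real.le_log_iff_exp_le (by positivity)]
  linarith [Real.exp_one_lt_three]

lemma one_add_log_one_add_le {n : ℕ} (hn : 3 ≤ n) :
    1 + Real.log (1 + n) ≤ 3 * Real.log n := by
  have hn' : (3 : ℝ) ≤ n := mod_cast hn
  have hsq : Real.log (1 + n) ≤ 2 * Real.log n := by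
    calc Real.log (1 + n) ≤ Real.log ((n : ℝ) ^ 2) :=
          Real.log_le_log (by positivity) (by nlinarith)
      _ = 2 * Real.log n := by rw [Real.log_pow, Nat.cast_ofNat]
  linarith [one_le_log_natCast hn]

lemma sqrt_one_add_log_one_add_le {n : ℕ} (hn : 3 ≤ n) :
    √(1 + Real.log (1 + n)) ≤ 2 * √(Real.log n) :=
  calc √(1 + Real.log (1 + n)) ≤ √(2 ^ 2 * Real.log n) :=
        Real.sqrt_le_sqrt (by linarith [one_add_log_one_add_le hn, one_le_log_natCast hn])
    _ = 2 * √(Real.log n) := by rw [Real.sqrt_mul (by positivity), Real.sqrt_sq zero_le_two]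

lemma sqrt_le_rpow_two_thirds {L : ℝ} (hL : 1 ≤ L) : √L ≤ L ^ (2 / 3 : ℝ) := by
  rw [Real.sqrt_eq_rpow]
  exact Real.rpow_le_rpow_of_exponent_le hL (by norm_num)

lemma bernoulliLaw_ae_mem_Icc {a b : ℝ} (hab : a ≤ b) :
    ∀ᵐ t ∂bernoulliLaw a b, t ∈ Set.Icc a b := by
  refine ae_add_measure_iff.2 ⟨Measure.ae_smul_measure ?_ _, Measure.ae_smul_measure ?_ _⟩
  · exact (ae_dirac_iff measurableSet_Icc).2 ⟨le_rfl, hab⟩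
  · exact (ae_dirac_iff measurableSet_Icc).2 ⟨hab, le_rfl⟩

end ElectricNetwork

open ElectricNetwork

theorem theorem1_general {a b : ℝ} (ha : 0 < a) (hab : a ≤ b) :
    ∃ c C : ℝ, 0 < c ∧ 0 < C ∧ ∀ (μ : squareLattice.edgeSet → Measure ℝ)
      [∀ e, IsProbabilityMeasure (μ e)], (∀ e, ∀ᵐ t ∂μ e, t ∈ Set.Icc a b) →
      (∀ v : ℤ × ℤ, v ≠ 0 → ∀ p,
        MemLp (fun r => squareLattice.effectiveResistance r 0 v) p (Measure.infinitePi μ)) ∧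
      ∀ v : ℤ × ℤ, 3 ≤ l1Norm v →
        Var[fun r => squareLattice.effectiveResistance r 0 v; Measure.infinitePi μ] ≤
          C * √(Real.log (l1Norm v)) ∧
        c * Real.log (l1Norm v) ≤
          ∫ r, squareLattice.effectiveResistance r 0 v ∂Measure.infinitePi μ ∧
        ∫ r, squareLattice.effectiveResistance r 0 v ∂Measure.infinitePi μ ≤
          C * Real.log (l1Norm v) := by
  have hb := ha.trans_le hab
  refine ⟨a / 128, max (9504 * (b - a) ^ 2 * b ^ 4 / a ^ 4) (198 * b), by positivity,
    lt_max_of_lt_right (by positivity), fun μ _ hμ => ⟨fun v hv p => ?_, fun v hv => ?_⟩⟩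
  · exact memLp_effectiveResistance ha hab squareLattice_connected squareLattice_isRecurrent
      hv.symm hμ p
  have hv₀ : 0 ≠ v := by
    rintro rfl
    simp [l1Norm] at hv
  have hlog := one_add_log_one_add_le hv
  have hsqrt := sqrt_one_add_log_one_add_le hv
  have hpos : (0 : ℝ) < l1Norm v := mod_cast (by omega : 0 < l1Norm v)
  have hvar := variance_effectiveResistance_squareLattice_le ha hab hv₀ hμ
  have hmean := integral_effectiveResistance_le_log ha hab hv₀ hμ
  rw [sub_zero] at hvar hmean
  refine ⟨hvar.trans ?_, le_trans ?_ (log_le_integral_effectiveResistance ha hab (by omega) hμ),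
    hmean.trans ?_⟩
  · calc _ ≤ 4752 * (b - a) ^ 2 * b ^ 4 / a ^ 4 * (2 * √(Real.log (l1Norm v))) := by gcongr
      _ = 9504 * (b - a) ^ 2 * b ^ 4 / a ^ 4 * √(Real.log (l1Norm v)) := by ring
      _ ≤ _ := mul_le_mul_of_nonneg_right (le_max_left _ _) (Real.sqrt_nonneg _)
  · exact mul_le_mul_of_nonneg_left (Real.log_le_log hpos (by linarith)) (by positivity)
  · calc _ ≤ 66 * b * (3 * Real.log (l1Norm v)) := by gcongr
      _ = 198 * b * Real.log (l1Norm v) := by ring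
      _ ≤ _ := mul_le_mul_of_nonneg_right (le_max_right _ _) (Real.log_natCast_nonneg _)

theorem theorem1 (a b : ℝ) (ha : 0 < a) (hab : a ≤ b) :
    (∀ v : ℤ × ℤ, v ≠ 0 →
      MemLp (fun r => squareLattice.effectiveResistance r 0 v) 2 (resistanceLaw a b)) ∧
    (∃ C : ℝ, 0 < C ∧ ∃ N : ℕ, ∀ v : ℤ × ℤ, N ≤ l1Norm v →
      variance (fun r => squareLattice.effectiveResistance r 0 v) (resistanceLaw a b)
        ≤ C * Real.log (l1Norm v : ℝ) ^ (2 / 3 : ℝ)) ∧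
    (∃ c C : ℝ, 0 < c ∧ 0 < C ∧ ∃ N : ℕ, ∀ v : ℤ × ℤ, N ≤ l1Norm v →
      c * Real.log (l1Norm v : ℝ)
          ≤ ∫ r, squareLattice.effectiveResistance r 0 v ∂(resistanceLaw a b) ∧
      ∫ r, squareLattice.effectiveResistance r 0 v ∂(resistanceLaw a b)
          ≤ C * Real.log (l1Norm v : ℝ)) := by
  obtain ⟨c, C, hc, hC, h⟩ := theorem1_general ha hab
  obtain ⟨hMemLp, hbounds⟩ := h (fun _ => bernoulliLaw a b) fun _ => bernoulliLaw_ae_mem_Icc hab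
  refine ⟨fun v hv => hMemLp v hv 2, ⟨C, hC, 3, fun v hv => (hbounds v hv).1.trans ?_⟩,
    c, C, hc, hC, 3, fun v hv => (hbounds v hv).2⟩
  exact mul_le_mul_of_nonneg_left (sqrt_le_rpow_two_thirds (one_le_log_natCast hv)) hC.le
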